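/- Let $(\Omega,\mathcal F,\mathbb P)$ be a probability space and let $L^0$ be the space of real random variables modulo $\mathbb P$-a.s. equality, with the a.s. order. A \emph{solid space} is a linear subspace $\mathcal X\subset L^0$ such that $|Y|\le|X|$ and $X\in\mathcal X$ imply $Y\in\mathcal X$. A \emph{monotone convex function} on a solid space $\mathcal X$ is a proper convex function $\varphi:\mathcal X\to(-\infty,\infty]$ such that $X\le Y$ implies $\varphi(X)\le\varphi(Y)$. It has the \emph{Lebesgue property} if $\varphi(X)=\lim_n\varphi(X_n)$ whenever $X_n,X,Y\in\mathcal X$, $|X_n|\le Y$ for all $n$, and $X_n\to X$ a.s. Let $\varphi_0:L^\infty\to\mathbb R$ be a finite-valued monotone convex function with the Lebesgue property and $\varphi_0(0)=0$. A \emph{Lebesgue extension} of $\varphi_0$ is a pair $(\varphi,\mathcal X)$ consisting of a solid space $\mathcal X\supset L^\infty$ and a monotone convex function $\varphi:\mathcal X\to(-\infty,\infty]$ with the Lebesgue property and $\varphi|_{L^\infty}=\varphi_0$. Put $$\varphi_0^*(Z)=\sup_{X\in L^\infty}\bigl(\mathbb E[XZ]-\varphi_0(X)\bigr)\quad(Z\in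 L^1),\qquad \operatorname{dom}\varphi_0^*=\{Z\in L^1:\varphi_0^*(Z)<\infty\},$$ $$\mathcal D_0=\{X\in L^0: X^-Z\in L^1\ \text{for all } Z\in\operatorname{dom}\varphi_0^*\},\qquad \hat\varphi(X)=\sup_{Z\in\operatorname{dom}\varphi_0^*}\bigl(\mathbb E[XZ]-\varphi_0^*(Z)\bigr)\quad(X\in\mathcal D_0),$$ $$M^{\hat\varphi}_u=\Bigl\{X\in L^0:\ \lim_{N\to\infty}\hat\varphi\bigl(\alpha|X|\mathbf 1_{\{|X|>N\}}\bigr)=0\ \text{ for all }\alpha>0\Bigr\}.$$ Then $(\hat\varphi,M^{\hat\varphi}_u)$ is the maximum Lebesgue extension of $\varphi_0$; that is: (1) $M^{\hat\varphi}_u$ is a solid subspace of $L^0$ containing $L^\infty$ and contained in $\mathcal D_0$, $\hat\varphi$ is finite-valued on $M^{\hat\varphi}_u$, and it is there a monotone convex function with the Lebesgue property such that $\hat\varphi|_{L^\infty}=\varphi_0$; (2) for every Lebesgue extension $(\varphi,\mathcal X)$ of $\varphi_0$ one has $\mathcal X\subset M^{\hat\varphi}_u$ and $\varphi=\hat\varphi|_{\mathcal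 X}$. -/

import Mathlib

open MeasureTheory Filter Topology
open scoped ENNReal

noncomputable section

namespace LebExt

/-- The space `L⁰` of (classes modulo a.s. equality of) finite real random variables. -/
abbrev L0 {Ω : Type*} [MeasurableSpace Ω] (P : Measure Ω) : Type _ := Ω →ₘ[P] ℝ

/-- The space `L^∞` as a linear subspace of `L⁰`. -/
abbrev LInfty {Ω : Type*} [MeasurableSpace Ω] (P : Measure Ω) : Submodule ℝ (L0 P) :=
  Lp.LpSubmodule ℝ ℝ ∞ P

section General

variable {Ω : Type*} [MeasurableSpace Ω] {P : Measure Ω}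

/-- A solid space: a linear subspace `𝒳` of `L⁰` such that `|Y| ≤ |X|` a.s. and `X ∈ 𝒳`
imply `Y ∈ 𝒳`. -/
def IsSolidSpace (𝒳 : Submodule ℝ (L0 P)) : Prop :=
  LatticeOrderedAddCommGroup.IsSolid (𝒳 : Set (L0 P))

/-- A monotone convex function `φ : 𝒳 → (-∞, ∞]`: proper, convex and increasing for the a.s.
order. -/
structure IsMonotoneConvex (𝒳 : Submodule ℝ (L0 P)) (φ : 𝒳 → EReal) : Prop where
  ne_bot : ∀ X, φ X ≠ ⊥
  proper : ∃ X, φ X ≠ ⊤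
  mono : ∀ X Y : 𝒳, (X : L0 P) ≤ (Y : L0 P) → φ X ≤ φ Y
  convex : ∀ (X Y : 𝒳) (a b : ℝ), 0 < a → 0 < b → a + b = 1 →
    φ (a • X + b • Y) ≤ (a : EReal) * φ X + (b : EReal) * φ Y

/-- The Lebesgue property: `φ (X n) → φ X` whenever `X n → X` a.s. and `|X n| ≤ Y` for all `n`
with some `Y ∈ 𝒳`. -/
def HasLebesgueProperty (𝒳 : Submodule ℝ (L0 P)) (φ : 𝒳 → EReal) : Prop :=
  ∀ (X : ℕ → 𝒳) (X' Y : 𝒳), (∀ n, |(X n : L0 P)| ≤ (Y : L0 P)) →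
    (∀ᵐ ω ∂P, Tendsto (fun n => (X n : L0 P) ω) atTop (𝓝 ((X' : L0 P) ω))) →
    Tendsto (fun n => φ (X n)) atTop (𝓝 (φ X'))

/-- `(φ, 𝒳)` is a Lebesgue extension of `(φ₀, 𝒳₀)`. -/
structure IsLebesgueExtension (𝒳₀ : Submodule ℝ (L0 P)) (φ₀ : 𝒳₀ → EReal)
    (𝒳 : Submodule ℝ (L0 P)) (φ : 𝒳 → EReal) : Prop where
  solid : IsSolidSpace 𝒳
  monotoneConvex : IsMonotoneConvex 𝒳 φ
  lebesgue : HasLebesgueProperty 𝒳 φ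
  extends_base : ∃ h : 𝒳₀ ≤ 𝒳, ∀ X : 𝒳₀, φ ⟨X, h X.2⟩ = φ₀ X

/-- `(φ, 𝒳)` is the maximum Lebesgue extension of `(φ₀, 𝒳₀)`. -/
structure IsMaximumLebesgueExtension (𝒳₀ : Submodule ℝ (L0 P)) (φ₀ : 𝒳₀ → EReal)
    (𝒳 : Submodule ℝ (L0 P)) (φ : 𝒳 → EReal) : Prop where
  isLebesgueExtension : IsLebesgueExtension 𝒳₀ φ₀ 𝒳 φ
  maximum : ∀ (𝒴 : Submodule ℝ (L0 P)) (ψ : 𝒴 → EReal), IsLebesgueExtension 𝒳₀ φ₀ 𝒴 ψ →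
    ∃ h : 𝒴 ≤ 𝒳, ∀ X : 𝒴, ψ X = φ ⟨X, h X.2⟩

end General

section Extension

variable {Ω : Type*} [MeasurableSpace Ω]

/-- The expectation `E[f⁺] - E[f⁻]` with values in `[-∞, ∞]`; it makes sense as soon as one of
the two terms is finite, and is only used in this case. -/
def expect (P : Measure Ω) (f : Ω → ℝ) : EReal :=
  ((∫⁻ ω, ENNReal.ofReal (f ω) ∂P : ℝ≥0∞) : EReal) -
    ((∫⁻ ω, ENNReal.ofReal (-f ω) ∂P : ℝ≥0∞) : EReal)

variable {P : Measure Ω}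

/-- The conjugate `φ₀*(Z) = sup_{X ∈ L^∞} (E[XZ] - φ₀(X))` for `Z ∈ L¹`. -/
def conjugate (φ₀ : LInfty P → ℝ) (Z : Lp ℝ 1 P) : EReal :=
  ⨆ X : LInfty P, (((∫ ω, (X : L0 P) ω * Z ω ∂P) - φ₀ X : ℝ) : EReal)

/-- The effective domain `dom φ₀* = {Z ∈ L¹ : φ₀*(Z) < ∞}`. -/
def domConjugate (φ₀ : LInfty P → ℝ) : Set (Lp ℝ 1 P) :=
  {Z | conjugate φ₀ Z < ⊤}

/-- The set `𝒟₀` of all `X ∈ L⁰` such that `X⁻ Z ∈ L¹` for all `Z ∈ dom φ₀*`. -/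
def D0 (φ₀ : LInfty P → ℝ) : Set (L0 P) :=
  {X | ∀ Z ∈ domConjugate φ₀, Integrable (fun ω => max (-(X ω)) 0 * Z ω) P}

/-- `φ̂(X) = sup_{Z ∈ dom φ₀*} (E[XZ] - φ₀*(Z))`, meaningful for `X ∈ 𝒟₀`. -/
def phiHat (φ₀ : LInfty P → ℝ) (X : L0 P) : EReal :=
  ⨆ Z ∈ domConjugate φ₀, (expect P (fun ω => X ω * Z ω) - conjugate φ₀ Z)

/-- The class of the random variable `|X| 1_{|X| > N}`. -/
def absTail (X : L0 P) (N : ℕ) : L0 P :=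
  AEEqFun.compMeasurable (Set.indicator {x : ℝ | (N : ℝ) < |x|} (fun x => |x|))
    (measurable_norm.indicator (measurableSet_lt measurable_const measurable_norm)) X

/-- The set `M_u = {X ∈ L⁰ : lim_N φ̂(α |X| 1_{|X| > N}) = 0 for all α > 0}`. -/
def Mu (φ₀ : LInfty P → ℝ) : Set (L0 P) :=
  {X | ∀ α : ℝ, 0 < α → Tendsto (fun N : ℕ => phiHat φ₀ (α • absTail X N)) atTop (𝓝 0)}

end Extension

end LebExt

end

/-!
The extension `φ̂` is built from the dual representation of `φ₀`. At every `X ∈ L^∞` the finite convex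
function `φ₀` has an algebraic subgradient (`exists_subgradient`); the Lebesgue property of `φ₀`
makes it continuous along order bounded a.s. null sequences, so that it is integration against an
`L¹` density (`exists_density`), which maximizes the dual expression (`exists_conjugate_eq`). Hence
`φ̂ = φ₀` on `L^∞` (`phiHat_linfty`). Densities in `dom φ₀*` are nonnegative
(`nonneg_of_mem_domConjugate`), so `φ̂` is monotone, and it is convex as a supremum of affine
functionals.

An element of `M_u` is a bounded part plus a tail `|X| 1_{|X| > N}` on which `φ̂` is small even after
scaling; by convexity, bounded part and tail are estimated separately (`phiHat_le_half`). This gives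
the linear structure of `M_u`, integrability against all densities, finiteness of `φ̂`, and
`φ̂(α |X_n - X|) → 0` under dominated a.s. convergence (`eventually_phiHat_le`). By convexity the
last fact bounds `limsup φ̂(X_n)` by `φ̂(X)`, while dominated convergence under each density gives
lower semicontinuity (`eventually_lt_phiHat`): together, the Lebesgue property.

For maximality, let `(ψ, 𝒴)` be a Lebesgue extension. By monotone convergence `φ̂ ≤ ψ` on nonnegative
elements (`phiHat_le_of_isLebesgueExtension`), and `ψ` tends to `0` along scaled tails by its
Lebesgue property, so `𝒴 ⊆ M_u`; finally `ψ` and `φ̂` agree on the bounded truncations of `X`, whose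
values converge to `ψ X` and to `φ̂ X`.
-/

namespace LebExt

/-! ### Subgradients of finite convex functions -/

/-- A finite convex function on a real vector space has an algebraic subgradient at every point:
its directional derivative `y ↦ inf_{t > 0} (φ (x + t y) - φ x) / t` is sublinear, and the
Hahn–Banach theorem gives a linear functional below it. -/
theorem exists_subgradient {E : Type*} [AddCommGroup E] [Module ℝ E] {φ : E → ℝ}
    (hφ : ConvexOn ℝ Set.univ φ) (x : E) :
    ∃ g : E →ₗ[ℝ] ℝ, ∀ y, g y ≤ φ (x + y) - φ x := by
  let q : E → {t : ℝ // 0 < t} → ℝ := fun y t => (φ (x + t.1 • y) - φ x) / t.1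
  have q_bdd : ∀ y, BddBelow (Set.range (q y)) := by
    -- The lower bound is the convexity inequality at `x`, between `x - y` and `x + t y`.
    refine fun y => ⟨φ x - φ (x - y), ?_⟩
    rintro _ ⟨⟨t, ht⟩, rfl⟩
    have h1 : (0 : ℝ) < 1 + t := by positivity
    have h := hφ.2 (Set.mem_univ (x - y)) (Set.mem_univ (x + t • y))
      (show 0 ≤ t / (1 + t) by positivity) (show 0 ≤ 1 / (1 + t) by positivity)
      (by field_simp; ring)
    have e : (t / (1 + t)) • (x - y) + (1 / (1 + t)) • (x + t • y) = x := by
      have e1 : t / (1 + t) = 1 - 1 / (1 + t) := by field_simp; ring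
      have e2 : 1 / (1 + t) * t = 1 - 1 / (1 + t) := by field_simp; ring
      rw [smul_add, smul_smul, e2, e1]
      module
    rw [e] at h
    simp only [smul_eq_mul] at h
    simp only [q]
    rw [le_div_iff₀ ht]
    have h2 : (1 + t) * φ x ≤ t * φ (x - y) + φ (x + t • y) := by
      calc (1 + t) * φ x ≤ (1 + t) * (t / (1 + t) * φ (x - y) + 1 / (1 + t) * φ (x + t • y)) := by
            gcongr
        _ = _ := by field_simp
    linarith
  have : Nonempty {t : ℝ // 0 < t} := ⟨⟨1, one_pos⟩⟩
  obtain ⟨g, -, hg⟩ := exists_extension_of_le_sublinear (⊥ : E →ₗ.[ℝ] ℝ) (fun y => ⨅ t, q y t)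
    (by
      intro c hc y
      have key : ∀ t : {t : ℝ // 0 < t}, q (c • y) t = c * q y ⟨t.1 * c, mul_pos t.2 hc⟩ := by
        rintro ⟨t, ht⟩
        simp only [q, smul_smul]
        field_simp
      apply le_antisymm
      · rw [← smul_eq_mul, Real.smul_iInf_of_nonneg hc.le]
        refine le_ciInf fun t => ?_
        have := key ⟨t.1 / c, div_pos t.2 hc⟩
        simp only [div_mul_cancel₀ _ hc.ne'] at this
        rw [smul_eq_mul, ← this]
        exact ciInf_le (q_bdd _) _
      · refine le_ciInf fun t => ?_
        rw [key]
        exact mul_le_mul_of_nonneg_left (ciInf_le (q_bdd _) _) hc.le)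
    (by
      intro y z
      refine le_ciInf_add_ciInf ?_
      rintro ⟨s, hs⟩ ⟨t, ht⟩
      have hst : 0 < s + t := add_pos hs ht
      -- With this step, `x + (s t / (s + t)) (y + z)` is the convex combination of `x + s y` and `x + t z`
      -- with weights `t / (s + t)` and `s / (s + t)`.
      refine (ciInf_le (q_bdd _) ⟨s * t / (s + t), by positivity⟩).trans ?_
      have h := hφ.2 (Set.mem_univ (x + s • y)) (Set.mem_univ (x + t • z))
        (show 0 ≤ t / (s + t) by positivity) (show 0 ≤ s / (s + t) by positivity)
        (by field_simp; ring)
      have e : (t / (s + t)) • (x + s • y) + (s / (s + t)) • (x + t • z)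
          = x + (s * t / (s + t)) • (y + z) := by
        have e1 : t / (s + t) = 1 - s / (s + t) := by field_simp; ring
        have e2 : t / (s + t) * s = s * t / (s + t) := by ring
        have e3 : s / (s + t) * t = s * t / (s + t) := by ring
        rw [smul_add, smul_add, smul_smul, smul_smul, e2, e3, e1]
        module
      rw [e] at h
      simp only [smul_eq_mul] at h
      simp only [q]
      rw [div_le_iff₀ (by positivity)]
      have e4 : ((φ (x + s • y) - φ x) / s + (φ (x + t • z) - φ x) / t) * (s * t / (s + t))
          = t / (s + t) * φ (x + s • y) + s / (s + t) * φ (x + t • z) - φ x := by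
        field_simp
        ring
      rw [e4]
      linarith)
    (by
      rintro ⟨y, hy⟩
      have hy0 : y = 0 := (Submodule.mem_bot ℝ).1 hy
      subst hy0
      have h0 : (⟨0, hy⟩ : (⊥ : E →ₗ.[ℝ] ℝ).domain) = 0 := rfl
      rw [h0, LinearPMap.map_zero]
      simp [q])
  refine ⟨g, fun y => (hg y).trans ((ciInf_le (q_bdd y) ⟨1, one_pos⟩).trans ?_)⟩
  simp [q]

/-! ### Functionals on `L^∞` represented by densities -/

section Density

variable {Ω : Type*} [MeasurableSpace Ω] {P : Measure Ω}

/-- The class in `L^∞` of an essentially bounded function. -/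
noncomputable def ofMemLp {f : Ω → ℝ} (hf : MemLp f ∞ P) : LInfty P :=
  ⟨(hf.toLp f : Lp ℝ ∞ P), (hf.toLp f).2⟩

theorem coeFn_ofMemLp {f : Ω → ℝ} (hf : MemLp f ∞ P) : ((ofMemLp hf : LInfty P) : L0 P) =ᵐ[P] f :=
  hf.coeFn_toLp

theorem linfty_ext {X Y : LInfty P} (h : (X : L0 P) =ᵐ[P] (Y : L0 P)) : X = Y :=
  Subtype.ext (AEEqFun.ext h)

theorem memLp_linfty (X : LInfty P) : MemLp (X : L0 P) ∞ P :=
  Lp.mem_Lp_iff_memLp.1 X.2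

theorem ae_norm_linfty_le (X : LInfty P) :
    ∀ᵐ ω ∂P, ‖(X : L0 P) ω‖ ≤ (eLpNorm (X : L0 P) ∞ P).toReal := by
  filter_upwards [ae_le_eLpNormEssSup (f := (X : L0 P)) (μ := P)] with ω h
  rw [← eLpNorm_exponent_top] at h
  rw [← toReal_enorm]
  exact ENNReal.toReal_mono (memLp_linfty X).2.ne h

theorem integrable_linfty_mul (X : LInfty P) {Z : Ω → ℝ} (hZ : Integrable Z P) :
    Integrable (fun ω => (X : L0 P) ω * Z ω) P :=
  hZ.mul_of_top_right (memLp_linfty X)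

theorem memLp_simpleFunc (s : SimpleFunc Ω ℝ) : MemLp s ∞ P := s.memLp_top P

variable [IsProbabilityMeasure P]

theorem memLp_indicator_one {A : Set Ω} (hA : MeasurableSet A) :
    MemLp (A.indicator fun _ => (1 : ℝ)) ∞ P :=
  (memLp_const 1).indicator hA

/-- Order boundedness in `L^∞`, for functions bounded by a constant. -/
theorem abs_le_ofMemLp_const {X : L0 P} {c : ℝ} (h : ∀ᵐ ω ∂P, |X ω| ≤ c) :
    |X| ≤ (ofMemLp (P := P) (memLp_const c) : LInfty P) := by
  rw [← AEEqFun.coeFn_le]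
  filter_upwards [h, AEEqFun.coeFn_abs X, coeFn_ofMemLp (P := P) (memLp_const c)] with ω h1 h2 h3
  rw [h2, h3]
  exact h1

/-- A linear functional on `L^∞` that is sequentially continuous along order bounded a.s. null
sequences is integration against an `L¹` density. The continuity gives at once the σ-additivity of
`A ↦ g 1_A`, whose Radon–Nikodym derivative is the density, and the passage from simple functions
to `L^∞`. -/
theorem exists_density (g : LInfty P →ₗ[ℝ] ℝ)
    (hg : ∀ (X : ℕ → LInfty P) (Y : LInfty P), (∀ n, |(X n : L0 P)| ≤ (Y : L0 P)) →
      (∀ᵐ ω ∂P, Tendsto (fun n => (X n : L0 P) ω) atTop (𝓝 0)) →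
      Tendsto (fun n => g (X n)) atTop (𝓝 0)) :
    ∃ Z : Lp ℝ 1 P, ∀ X : LInfty P, g X = ∫ ω, (X : L0 P) ω * Z ω ∂P := by
  classical
  let m : Set Ω → ℝ := fun A =>
    if hA : MeasurableSet A then g (ofMemLp (memLp_indicator_one (P := P) hA)) else 0
  have m_eq : ∀ {A : Set Ω} (hA : MeasurableSet A),
      m A = g (ofMemLp (memLp_indicator_one (P := P) hA)) := fun hA => dif_pos hA
  have g_eq : ∀ {X Y : LInfty P}, (X : L0 P) =ᵐ[P] (Y : L0 P) → g X = g Y :=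
    fun h => by rw [linfty_ext h]
  have m_null : ∀ {A : Set Ω}, MeasurableSet A → P A = 0 → m A = 0 := by
    intro A hA h0
    rw [m_eq hA, ← map_zero g]
    refine g_eq ?_
    have : ∀ᵐ ω ∂P, ω ∉ A := measure_eq_zero_iff_ae_notMem.1 h0
    filter_upwards [this, coeFn_ofMemLp (P := P) (memLp_indicator_one (P := P) hA),
      AEEqFun.coeFn_zero (μ := P) (β := ℝ)] with ω h1 h2 h3
    rw [h2, Submodule.coe_zero, h3]
    simp [h1]
  have m_union : ∀ {A B : Set Ω}, MeasurableSet A → MeasurableSet B → Disjoint A B →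
      m (A ∪ B) = m A + m B := by
    intro A B hA hB hAB
    rw [m_eq hA, m_eq hB, m_eq (hA.union hB), ← map_add]
    refine g_eq ?_
    rw [Submodule.coe_add]
    filter_upwards [coeFn_ofMemLp (memLp_indicator_one (P := P) hA),
      coeFn_ofMemLp (memLp_indicator_one (P := P) hB),
      coeFn_ofMemLp (memLp_indicator_one (P := P) (hA.union hB)),
      AEEqFun.coeFn_add ((ofMemLp (memLp_indicator_one (P := P) hA) : LInfty P) : L0 P)
        (ofMemLp (memLp_indicator_one (P := P) hB) : LInfty P)] with ω h1 h2 h3 h4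
    rw [h4, Pi.add_apply, h1, h2, h3, Set.indicator_union_of_disjoint hAB]
  have m_empty : m ∅ = 0 := m_null MeasurableSet.empty measure_empty
  -- Continuity from above at `∅`, in the form used for countable unions.
  have m_tendsto : ∀ {B : ℕ → Set Ω}, (∀ n, MeasurableSet (B n)) →
      (∀ ω, ∀ᶠ n in atTop, ω ∉ B n) → Tendsto (fun n => m (B n)) atTop (𝓝 0) := by
    intro B hB h
    simp only [fun n => m_eq (hB n)]
    refine hg _ (ofMemLp (memLp_const 1)) (fun n => abs_le_ofMemLp_const ?_) ?_
    · filter_upwards [coeFn_ofMemLp (memLp_indicator_one (P := P) (hB n))] with ω h1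
      rw [h1]
      by_cases hω : ω ∈ B n <;> simp [hω]
    · have : ∀ᵐ ω ∂P, ∀ n, ((ofMemLp (memLp_indicator_one (P := P) (hB n)) : LInfty P) : L0 P) ω =
          (B n).indicator (fun _ => (1 : ℝ)) ω :=
        ae_all_iff.2 fun n => coeFn_ofMemLp (memLp_indicator_one (P := P) (hB n))
      filter_upwards [this] with ω h1
      refine tendsto_const_nhds.congr' ?_
      filter_upwards [h ω] with n hn
      simp [h1, hn]
  have m_hasSum : ∀ {f : ℕ → Set Ω}, (∀ i, MeasurableSet (f i)) →
      Pairwise (Function.onFun Disjoint f) → HasSum (fun i => m (f i)) (m (⋃ i, f i)) := by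
    intro f hf hd
    have hmeas : ∀ S : Finset ℕ, MeasurableSet (⋃ i ∈ S, f i) := fun S =>
      Finset.measurableSet_biUnion _ fun i _ => hf i
    have hpart : ∀ S : Finset ℕ, m (⋃ i ∈ S, f i) = ∑ i ∈ S, m (f i) := by
      intro S
      induction S using Finset.induction_on with
      | empty => simpa using m_empty
      | insert n S hn ih =>
        rw [Finset.sum_insert hn, ← ih, Finset.set_biUnion_insert, m_union (hf n) (hmeas S)]
        exact Set.disjoint_iUnion₂_right.2 fun i hi => hd (ne_of_mem_of_not_mem hi hn).symm
    have hsplit : ∀ S : Finset ℕ, ∑ i ∈ S, m (f i) =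
        m (⋃ i, f i) - m ((⋃ i, f i) \ ⋃ i ∈ S, f i) := by
      intro S
      have := m_union (hmeas S) ((MeasurableSet.iUnion hf).diff (hmeas S)) Set.disjoint_sdiff_right
      rw [Set.union_sdiff_cancel (Set.iUnion₂_subset fun i _ => Set.subset_iUnion f i), hpart] at this
      linarith
    rw [HasSum, SummationFilter.unconditional_filter]
    -- `m` may take both signs, so unordered summation is tested along sequences of finite sets, to
    -- which continuity from above still applies.
    refine tendsto_of_seq_tendsto fun S hS => ?_
    simp only [hsplit]
    have := m_tendsto (B := fun n => (⋃ i, f i) \ ⋃ i ∈ S n, f i)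
      (fun n => (MeasurableSet.iUnion hf).diff (hmeas _)) ?_
    · simpa [Function.comp_def] using this.const_sub (m (⋃ i, f i))
    · intro ω
      by_cases hω : ω ∈ ⋃ i, f i
      · obtain ⟨i, hi⟩ := Set.mem_iUnion.1 hω
        filter_upwards [hS.eventually_ge_atTop {i}] with n hn hmem
        exact hmem.2 (Set.mem_biUnion (Finset.mem_coe.2 (hn (Finset.mem_singleton_self i))) hi)
      · exact Eventually.of_forall fun n hmem => hω hmem.1
  let s : SignedMeasure Ω :=
    { measureOf' := m
      empty' := m_empty
      not_measurable' := fun A hA => dif_neg hA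
      m_iUnion' := fun f hf hd => m_hasSum hf hd }
  have s_apply : ∀ A, s A = m A := fun A => rfl
  have hac : s ≪ᵥ P.toENNRealVectorMeasure := by
    refine VectorMeasure.AbsolutelyContinuous.mk fun A hA h0 => ?_
    rw [Measure.toENNRealVectorMeasure_apply_measurable hA] at h0
    exact m_null hA h0
  have hZi : Integrable (s.rnDeriv P) P := SignedMeasure.integrable_rnDeriv s P
  have hset : ∀ A, MeasurableSet A → m A = ∫ ω in A, s.rnDeriv P ω ∂P := by
    intro A hA
    rw [← withDensityᵥ_apply hZi hA, SignedMeasure.withDensityᵥ_rnDeriv_eq s P hac, s_apply]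
  have hsimple : ∀ t : SimpleFunc Ω ℝ,
      g (ofMemLp (memLp_simpleFunc (P := P) t)) = ∫ ω, t ω * s.rnDeriv P ω ∂P := by
    intro t
    induction t using SimpleFunc.induction with
    | const c hA =>
      rename_i A
      have : g (ofMemLp (memLp_simpleFunc (P := P) (SimpleFunc.piecewise A hA
          (SimpleFunc.const Ω c) (SimpleFunc.const Ω 0)))) = c * m A := by
        rw [m_eq hA, ← smul_eq_mul, ← map_smul]
        refine g_eq ?_
        rw [Submodule.coe_smul]
        filter_upwards [coeFn_ofMemLp (memLp_indicator_one (P := P) hA),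
          coeFn_ofMemLp (memLp_simpleFunc (P := P) (SimpleFunc.piecewise A hA
            (SimpleFunc.const Ω c) (SimpleFunc.const Ω 0))),
          AEEqFun.coeFn_smul c ((ofMemLp (memLp_indicator_one (P := P) hA) : LInfty P) : L0 P)]
          with ω h1 h2 h3
        rw [h2, h3, Pi.smul_apply, h1]
        by_cases hω : ω ∈ A <;> simp [hω]
      rw [this, hset A hA, ← integral_const_mul, ← integral_indicator hA]
      refine integral_congr_ae (Eventually.of_forall fun ω => ?_)
      by_cases hω : ω ∈ A <;> simp [hω]
    | @add t₁ t₂ h12 h1 h2 =>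
      have e : g (ofMemLp (memLp_simpleFunc (P := P) (t₁ + t₂))) =
          g (ofMemLp (memLp_simpleFunc (P := P) t₁)) + g (ofMemLp (memLp_simpleFunc (P := P) t₂)) := by
        rw [← map_add]
        refine g_eq ?_
        rw [Submodule.coe_add]
        filter_upwards [coeFn_ofMemLp (memLp_simpleFunc (P := P) (t₁ + t₂)),
          coeFn_ofMemLp (memLp_simpleFunc (P := P) t₁), coeFn_ofMemLp (memLp_simpleFunc (P := P) t₂),
          AEEqFun.coeFn_add ((ofMemLp (memLp_simpleFunc (P := P) t₁) : LInfty P) : L0 P)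
            (ofMemLp (memLp_simpleFunc (P := P) t₂) : LInfty P)] with ω h3 h4 h5 h6
        rw [h3, h6, Pi.add_apply, h4, h5, SimpleFunc.add_apply]
      rw [e, h1, h2]
      refine (integral_add (hZi.mul_of_top_right (memLp_simpleFunc t₁))
        (hZi.mul_of_top_right (memLp_simpleFunc t₂))).symm.trans ?_
      refine integral_congr_ae (Eventually.of_forall fun ω => ?_)
      simp [add_mul]
  refine ⟨hZi.toL1 _, fun X => ?_⟩
  have hZae : ∀ᵐ ω ∂P, (hZi.toL1 _ : Lp ℝ 1 P) ω = s.rnDeriv P ω := hZi.coeFn_toL1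
  have hXint : ∫ ω, (X : L0 P) ω * (hZi.toL1 _ : Lp ℝ 1 P) ω ∂P =
      ∫ ω, (X : L0 P) ω * s.rnDeriv P ω ∂P := by
    refine integral_congr_ae ?_
    filter_upwards [hZae] with ω h1
    rw [h1]
  rw [hXint]
  let c : ℝ := (eLpNorm (X : L0 P) ∞ P).toReal
  have hc0 : 0 ≤ c := ENNReal.toReal_nonneg
  have hc : ∀ᵐ ω ∂P, ‖(X : L0 P) ω‖ ≤ c := ae_norm_linfty_le X
  have hXm : StronglyMeasurable (X : L0 P) := AEEqFun.stronglyMeasurable _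
  let t : ℕ → SimpleFunc Ω ℝ := hXm.approxBounded c
  have ht : ∀ᵐ ω ∂P, Tendsto (fun n => t n ω) atTop (𝓝 ((X : L0 P) ω)) :=
    hXm.tendsto_approxBounded_ae hc
  have htc : ∀ n ω, ‖t n ω‖ ≤ c := fun n ω => hXm.norm_approxBounded_le hc0 n ω
  have lim1 : Tendsto (fun n => g (ofMemLp (memLp_simpleFunc (P := P) (t n)))) atTop
      (𝓝 (∫ ω, (X : L0 P) ω * s.rnDeriv P ω ∂P)) := by
    simp only [hsimple]
    refine tendsto_integral_of_dominated_convergence (fun ω => c * ‖s.rnDeriv P ω‖) (fun n => ?_)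
      (hZi.norm.const_mul c) (fun n => ?_) ?_
    · exact (hZi.mul_of_top_right (memLp_simpleFunc (t n))).aestronglyMeasurable
    · refine Eventually.of_forall fun ω => ?_
      rw [norm_mul]
      exact mul_le_mul_of_nonneg_right (htc n ω) (norm_nonneg _)
    · filter_upwards [ht] with ω h1
      exact h1.mul_const _
  have lim2 : Tendsto (fun n => g (ofMemLp (memLp_simpleFunc (P := P) (t n)) - X)) atTop (𝓝 0) := by
    have hsub : ∀ᵐ ω ∂P, ∀ n, ((ofMemLp (memLp_simpleFunc (P := P) (t n)) - X : LInfty P) : L0 P) ω =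
        t n ω - (X : L0 P) ω := by
      refine ae_all_iff.2 fun n => ?_
      rw [Submodule.coe_sub]
      filter_upwards [coeFn_ofMemLp (memLp_simpleFunc (P := P) (t n)), AEEqFun.coeFn_sub
        ((ofMemLp (memLp_simpleFunc (P := P) (t n)) : LInfty P) : L0 P) (X : L0 P)] with ω h1 h2
      rw [h2, Pi.sub_apply, h1]
    refine hg _ (ofMemLp (memLp_const (c + c))) (fun n => abs_le_ofMemLp_const ?_) ?_
    · filter_upwards [hsub, hc] with ω h1 h2
      rw [h1 n]
      exact (norm_sub_le _ _).trans (add_le_add (htc n ω) h2)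
    · filter_upwards [hsub, ht] with ω h1 h2
      simp only [h1]
      simpa using h2.sub_const ((X : L0 P) ω)
  have lim3 : Tendsto (fun n => g (ofMemLp (memLp_simpleFunc (P := P) (t n)))) atTop (𝓝 (g X)) := by
    have := lim2.add_const (g X)
    simpa using this
  exact tendsto_nhds_unique lim3 lim1

end Density

/-! ### The dual representation on `L^∞` -/

section Dual

variable {Ω : Type*} [MeasurableSpace Ω] {P : Measure Ω}

theorem abs_abs_l0 (X : L0 P) : |(|X|)| = |X| := by
  refine AEEqFun.ext ?_
  filter_upwards [AEEqFun.coeFn_abs X, AEEqFun.coeFn_abs |X|] with ω h1 h2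
  rw [h2, h1, abs_abs]

theorem isSolid_linfty : IsSolidSpace (LInfty P) := by
  intro X hX Y hYX
  have hX' : X ∈ Lp ℝ ∞ P := hX
  rw [← AEEqFun.coeFn_le] at hYX
  refine (Lp.mem_Lp_iff_memLp.2 (MemLp.mono (Lp.mem_Lp_iff_memLp.1 hX')
    (AEEqFun.aestronglyMeasurable Y) ?_) : Y ∈ Lp ℝ ∞ P)
  filter_upwards [hYX, AEEqFun.coeFn_abs X, AEEqFun.coeFn_abs Y] with ω h1 h2 h3
  rw [h2, h3] at h1
  exact h1

/-- The standing hypotheses on the initial function `φ₀ : L^∞ → ℝ`, as statements about real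
numbers. -/
structure IsLebesgueBase (φ₀ : LInfty P → ℝ) : Prop where
  convexOn : ConvexOn ℝ Set.univ φ₀
  mono : ∀ X Y : LInfty P, (X : L0 P) ≤ (Y : L0 P) → φ₀ X ≤ φ₀ Y
  tendsto : ∀ (X : ℕ → LInfty P) (X' Y : LInfty P), (∀ n, |(X n : L0 P)| ≤ (Y : L0 P)) →
    (∀ᵐ ω ∂P, Tendsto (fun n => (X n : L0 P) ω) atTop (𝓝 ((X' : L0 P) ω))) →
    Tendsto (fun n => φ₀ (X n)) atTop (𝓝 (φ₀ X'))
  zero : φ₀ 0 = 0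

theorem isLebesgueBase {φ₀ : LInfty P → ℝ}
    (hconv : IsMonotoneConvex (LInfty P) (fun X => (φ₀ X : EReal)))
    (hleb : HasLebesgueProperty (LInfty P) (fun X => (φ₀ X : EReal)))
    (hzero : φ₀ 0 = 0) : IsLebesgueBase φ₀ where
  convexOn := by
    refine convexOn_iff_forall_pos.2 ⟨convex_univ, fun X _ Y _ a b ha hb hab => ?_⟩
    have := hconv.convex X Y a b ha hb hab
    simp only [smul_eq_mul]
    exact_mod_cast this
  mono X Y h := by exact_mod_cast hconv.mono X Y h
  tendsto X X' Y h1 h2 := EReal.tendsto_coe.1 (hleb X X' Y h1 h2)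
  zero := hzero

variable {φ₀ : LInfty P → ℝ}

theorem integral_sub_le_conjugate (X : LInfty P) (Z : Lp ℝ 1 P) :
    (((∫ ω, (X : L0 P) ω * Z ω ∂P) - φ₀ X : ℝ) : EReal) ≤ conjugate φ₀ Z :=
  le_iSup (fun X : LInfty P => (((∫ ω, (X : L0 P) ω * Z ω ∂P) - φ₀ X : ℝ) : EReal)) X

theorem coe_toReal_conjugate {Z : Lp ℝ 1 P} (hZ : Z ∈ domConjugate φ₀) :
    ((conjugate φ₀ Z).toReal : EReal) = conjugate φ₀ Z :=
  EReal.coe_toReal (ne_of_lt hZ)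
    (ne_of_gt ((EReal.bot_lt_coe _).trans_le (integral_sub_le_conjugate 0 Z)))

/-- The Fenchel–Young inequality. -/
theorem integral_sub_le_toReal_conjugate (X : LInfty P) {Z : Lp ℝ 1 P}
    (hZ : Z ∈ domConjugate φ₀) :
    (∫ ω, (X : L0 P) ω * Z ω ∂P) - φ₀ X ≤ (conjugate φ₀ Z).toReal := by
  have := integral_sub_le_conjugate (φ₀ := φ₀) X Z
  rw [← coe_toReal_conjugate hZ] at this
  exact_mod_cast this

theorem integrable_coe (Z : Lp ℝ 1 P) : Integrable Z P := L1.integrable_coeFn Z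

variable [IsProbabilityMeasure P]

/-- Densities in the effective domain are nonnegative, because `φ₀ ≤ 0` on the ray
`-t 1_{Z < 0}`, along which `E[XZ] = t E[Z⁻]`. -/
theorem nonneg_of_mem_domConjugate (h₀ : IsLebesgueBase φ₀) {Z : Lp ℝ 1 P}
    (hZ : Z ∈ domConjugate φ₀) : ∀ᵐ ω ∂P, 0 ≤ Z ω := by
  have hA : MeasurableSet {ω | Z ω < 0} :=
    measurableSet_lt (Lp.stronglyMeasurable Z).measurable measurable_const
  let W : LInfty P := ofMemLp (memLp_indicator_one (P := P) hA)
  have hW : (W : L0 P) =ᵐ[P] _ := coeFn_ofMemLp (memLp_indicator_one (P := P) hA)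
  have hWt : ∀ t : ℝ, ((-t) • W : LInfty P) =ᵐ[P] fun ω => -t * (W : L0 P) ω := fun t =>
    AEEqFun.coeFn_smul (-t) (W : L0 P)
  have key : ∀ t : ℝ, 0 ≤ t →
      t * ∫ ω, max (-(Z ω)) 0 ∂P ≤ (conjugate φ₀ Z).toReal := by
    intro t ht
    have h1 : φ₀ ((-t) • W) ≤ 0 := by
      rw [← h₀.zero]
      refine h₀.mono _ _ ?_
      rw [← AEEqFun.coeFn_le, Submodule.coe_zero]
      filter_upwards [hWt t, hW, AEEqFun.coeFn_zero (μ := P) (β := ℝ)] with ω e1 e2 e3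
      rw [e1, e2, e3]
      by_cases hω : Z ω < 0 <;> simp [hω, ht]
    have h2 := integral_sub_le_toReal_conjugate ((-t) • W) hZ
    have h3 : ∫ ω, (((-t) • W : LInfty P) : L0 P) ω * Z ω ∂P = t * ∫ ω, max (-(Z ω)) 0 ∂P := by
      rw [← integral_const_mul]
      refine integral_congr_ae ?_
      filter_upwards [hWt t, hW] with ω e1 e2
      rw [e1, e2]
      by_cases hω : Z ω < 0
      · simp [hω, hω.le]
      · simp [hω, not_lt.1 hω]
    linarith
  have hint : Integrable (fun ω => max (-(Z ω)) 0) P := (integrable_coe Z).neg.pos_part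
  have hnn : ∀ ω, 0 ≤ max (-(Z ω)) 0 := fun ω => le_max_right _ _
  have hzero : ∫ ω, max (-(Z ω)) 0 ∂P = 0 := by
    refine le_antisymm (not_lt.1 fun hpos => ?_) (integral_nonneg hnn)
    have hc : 0 ≤ (conjugate φ₀ Z).toReal := by simpa using key 0 le_rfl
    have := key (((conjugate φ₀ Z).toReal + 1) / ∫ ω, max (-(Z ω)) 0 ∂P) (by positivity)
    rw [div_mul_cancel₀ _ hpos.ne'] at this
    linarith
  rw [integral_eq_zero_iff_of_nonneg hnn hint] at hzero
  filter_upwards [hzero] with ω hω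
  have : -(Z ω) ≤ 0 := (le_max_left _ _).trans_eq hω
  linarith

/-- The supremum in the dual representation of `φ₀` is attained on `L^∞`: the density of a
subgradient at `X` is a maximizer. The Lebesgue property makes the subgradient
order continuous. -/
theorem exists_conjugate_eq (h₀ : IsLebesgueBase φ₀) (X : LInfty P) :
    ∃ Z ∈ domConjugate φ₀, conjugate φ₀ Z = (((∫ ω, (X : L0 P) ω * Z ω ∂P) - φ₀ X : ℝ) : EReal) := by
  obtain ⟨g, hg⟩ := exists_subgradient h₀.convexOn X
  have habs : |(X : L0 P)| ∈ LInfty P := isSolid_linfty X.2 (abs_abs_l0 _).le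
  have lim : ∀ (W : ℕ → LInfty P) (Y : LInfty P), (∀ n, |(W n : L0 P)| ≤ (Y : L0 P)) →
      (∀ᵐ ω ∂P, Tendsto (fun n => (W n : L0 P) ω) atTop (𝓝 0)) →
      Tendsto (fun n => φ₀ (X + W n) - φ₀ X) atTop (𝓝 0) := by
    intro W Y hWY hW
    have := h₀.tendsto (fun n => X + W n) X (⟨_, habs⟩ + Y) (fun n => ?_) ?_
    · simpa using this.sub_const (φ₀ X)
    · rw [Submodule.coe_add, Submodule.coe_add, ← AEEqFun.coeFn_le]
      have h1 := AEEqFun.coeFn_le.2 (hWY n)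
      filter_upwards [h1, AEEqFun.coeFn_abs (X : L0 P), AEEqFun.coeFn_abs (W n : L0 P),
        AEEqFun.coeFn_abs ((X : L0 P) + (W n : L0 P)),
        AEEqFun.coeFn_add (X : L0 P) (W n : L0 P),
        AEEqFun.coeFn_add |(X : L0 P)| (Y : L0 P)] with ω e1 e2 e3 e4 e5 e6
      rw [e4, e5, e6, Pi.add_apply, Pi.add_apply, e2]
      rw [e3] at e1
      exact (abs_add_le _ _).trans (by gcongr)
    · have : ∀ᵐ ω ∂P, ∀ n, ((X + W n : LInfty P) : L0 P) ω = (X : L0 P) ω + (W n : L0 P) ω :=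
        ae_all_iff.2 fun n => AEEqFun.coeFn_add (X : L0 P) (W n)
      filter_upwards [this, hW] with ω e1 e2
      simp only [e1]
      simpa using e2.const_add ((X : L0 P) ω)
  obtain ⟨Z, hZ⟩ := exists_density g (fun W Y hWY hW => by
    have hneg := lim (fun n => -W n) Y (fun n => by simpa using hWY n) (by
      have : ∀ᵐ ω ∂P, ∀ n, ((-W n : LInfty P) : L0 P) ω = -(W n : L0 P) ω :=
        ae_all_iff.2 fun n => AEEqFun.coeFn_neg (W n : L0 P)
      filter_upwards [this, hW] with ω e1 e2
      simp only [e1]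
      simpa using e2.neg)
    refine tendsto_of_tendsto_of_tendsto_of_le_of_le (by simpa using hneg.neg) (lim W Y hWY hW)
      (fun n => ?_) (fun n => hg _)
    have := hg (-W n)
    rw [map_neg] at this
    simp only
    linarith)
  have heq : conjugate φ₀ Z = (((∫ ω, (X : L0 P) ω * Z ω ∂P) - φ₀ X : ℝ) : EReal) := by
    refine le_antisymm (iSup_le fun Y => ?_) (integral_sub_le_conjugate X Z)
    rw [EReal.coe_le_coe_iff, ← hZ, ← hZ]
    have := hg (Y - X)
    rw [map_sub, add_sub_cancel] at this
    linarith
  refine ⟨Z, ?_, heq⟩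
  change conjugate φ₀ Z < ⊤
  rw [heq]
  exact EReal.coe_lt_top _

end Dual

/-! ### Expectations and the function `φ̂` -/

section PhiHat

variable {Ω : Type*} [MeasurableSpace Ω] {P : Measure Ω} {φ₀ : LInfty P → ℝ}

theorem expect_mono {f g : Ω → ℝ} (h : f ≤ᵐ[P] g) : expect P f ≤ expect P g := by
  refine EReal.sub_le_sub ?_ ?_ <;> rw [EReal.coe_ennreal_le_coe_ennreal_iff] <;>
    refine lintegral_mono_ae ?_ <;> filter_upwards [h] with ω hω
  · exact ENNReal.ofReal_le_ofReal hω
  · exact ENNReal.ofReal_le_ofReal (neg_le_neg hω)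

theorem expect_eq_integral {f : Ω → ℝ} (hf : Integrable f P) : expect P f = (∫ ω, f ω ∂P : ℝ) := by
  rw [integral_eq_lintegral_pos_part_sub_lintegral_neg_part hf, EReal.coe_sub,
    EReal.coe_ennreal_toReal hf.lintegral_lt_top.ne,
    EReal.coe_ennreal_toReal (show ∫⁻ ω, ENNReal.ofReal (-f ω) ∂P ≠ ∞ from
      hf.neg.lintegral_lt_top.ne)]
  rfl

theorem expect_of_nonneg {f : Ω → ℝ} (hf : ∀ᵐ ω ∂P, 0 ≤ f ω) :
    expect P f = ((∫⁻ ω, ENNReal.ofReal (f ω) ∂P : ℝ≥0∞) : EReal) := by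
  have : ∫⁻ ω, ENNReal.ofReal (-f ω) ∂P = 0 := by
    rw [← lintegral_zero (μ := P)]
    refine lintegral_congr_ae ?_
    filter_upwards [hf] with ω hω
    simpa using hω
  rw [expect, this]
  simp

/-- `X` is integrable against every density in the effective domain of `φ₀*`. -/
def DualIntegrable (φ₀ : LInfty P → ℝ) (X : L0 P) : Prop :=
  ∀ Z ∈ domConjugate φ₀, Integrable (fun ω => X ω * Z ω) P

theorem DualIntegrable.add {X Y : L0 P} (hX : DualIntegrable φ₀ X) (hY : DualIntegrable φ₀ Y) :
    DualIntegrable φ₀ (X + Y) := by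
  intro Z hZ
  refine ((hX Z hZ).add (hY Z hZ)).congr ?_
  filter_upwards [AEEqFun.coeFn_add X Y] with ω h1
  rw [h1, Pi.add_apply, Pi.add_apply, add_mul]

theorem DualIntegrable.smul {X : L0 P} (hX : DualIntegrable φ₀ X) (a : ℝ) :
    DualIntegrable φ₀ (a • X) := by
  intro Z hZ
  refine ((hX Z hZ).const_mul a).congr ?_
  filter_upwards [AEEqFun.coeFn_smul a X] with ω h1
  rw [h1, Pi.smul_apply, smul_eq_mul, mul_assoc]

theorem DualIntegrable.mono {X Y : L0 P} (hX : DualIntegrable φ₀ X) (h : |Y| ≤ |X|) :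
    DualIntegrable φ₀ Y := by
  intro Z hZ
  refine (hX Z hZ).mono ((AEEqFun.aestronglyMeasurable Y).mul (integrable_coe Z).1) ?_
  rw [← AEEqFun.coeFn_le] at h
  filter_upwards [h, AEEqFun.coeFn_abs X, AEEqFun.coeFn_abs Y] with ω h1 h2 h3
  rw [h2, h3] at h1
  rw [norm_mul, norm_mul]
  exact mul_le_mul_of_nonneg_right h1 (norm_nonneg _)

theorem dualIntegrable_linfty (X : LInfty P) : DualIntegrable φ₀ X :=
  fun Z _ => integrable_linfty_mul X (integrable_coe Z)

theorem DualIntegrable.expect_sub {X : L0 P} (hX : DualIntegrable φ₀ X) {Z : Lp ℝ 1 P}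
    (hZ : Z ∈ domConjugate φ₀) :
    expect P (fun ω => X ω * Z ω) - conjugate φ₀ Z =
      ((∫ ω, X ω * Z ω ∂P) - (conjugate φ₀ Z).toReal : ℝ) := by
  rw [expect_eq_integral (hX Z hZ), EReal.coe_sub, coe_toReal_conjugate hZ]

theorem DualIntegrable.phiHat_le_iff {X : L0 P} (hX : DualIntegrable φ₀ X) {r : ℝ} :
    phiHat φ₀ X ≤ r ↔
      ∀ Z ∈ domConjugate φ₀, (∫ ω, X ω * Z ω ∂P) - (conjugate φ₀ Z).toReal ≤ r := by
  rw [phiHat, iSup₂_le_iff]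
  refine forall₂_congr fun Z hZ => ?_
  rw [hX.expect_sub hZ, EReal.coe_le_coe_iff]

theorem le_phiHat (X : L0 P) {Z : Lp ℝ 1 P} (hZ : Z ∈ domConjugate φ₀) :
    expect P (fun ω => X ω * Z ω) - conjugate φ₀ Z ≤ phiHat φ₀ X :=
  le_iSup₂ (f := fun (Z : Lp ℝ 1 P) (_ : Z ∈ domConjugate φ₀) =>
    expect P (fun ω => X ω * Z ω) - conjugate φ₀ Z) Z hZ

theorem phiHat_convex {X Y : L0 P} (hX : DualIntegrable φ₀ X) (hY : DualIntegrable φ₀ Y)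
    {a b r s : ℝ} (ha : 0 ≤ a) (hb : 0 ≤ b) (hab : a + b = 1) (hr : phiHat φ₀ X ≤ r)
    (hs : phiHat φ₀ Y ≤ s) : phiHat φ₀ (a • X + b • Y) ≤ (a * r + b * s : ℝ) := by
  rw [((hX.smul a).add (hY.smul b)).phiHat_le_iff]
  rw [hX.phiHat_le_iff] at hr
  rw [hY.phiHat_le_iff] at hs
  intro Z hZ
  have : ∫ ω, (a • X + b • Y) ω * Z ω ∂P = a * ∫ ω, X ω * Z ω ∂P + b * ∫ ω, Y ω * Z ω ∂P := by
    rw [← integral_const_mul, ← integral_const_mul, ← integral_add ((hX Z hZ).const_mul a)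
      ((hY Z hZ).const_mul b)]
    refine integral_congr_ae ?_
    filter_upwards [AEEqFun.coeFn_add (a • X) (b • Y), AEEqFun.coeFn_smul a X,
      AEEqFun.coeFn_smul b Y] with ω h1 h2 h3
    rw [h1, Pi.add_apply, h2, h3]
    simp only [Pi.smul_apply, smul_eq_mul]
    ring
  rw [this]
  have h1 := mul_le_mul_of_nonneg_left (hr Z hZ) ha
  have h2 := mul_le_mul_of_nonneg_left (hs Z hZ) hb
  have h3 : (conjugate φ₀ Z).toReal =
      a * (conjugate φ₀ Z).toReal + b * (conjugate φ₀ Z).toReal := by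
    rw [← add_mul, hab, one_mul]
  linarith

variable [IsProbabilityMeasure P]

/-- Monotonicity holds on all of `L⁰`: the difference defining `expect` is monotone in `EReal` even
where both parts are infinite. -/
theorem phiHat_mono (h₀ : IsLebesgueBase φ₀) {X Y : L0 P} (h : X ≤ Y) :
    phiHat φ₀ X ≤ phiHat φ₀ Y := by
  refine iSup₂_mono fun Z hZ => EReal.sub_le_sub (expect_mono ?_) le_rfl
  filter_upwards [AEEqFun.coeFn_le.2 h, nonneg_of_mem_domConjugate h₀ hZ] with ω h1 h2
  exact mul_le_mul_of_nonneg_right h1 h2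

theorem phiHat_linfty (h₀ : IsLebesgueBase φ₀) (X : LInfty P) : phiHat φ₀ X = φ₀ X := by
  refine le_antisymm ((dualIntegrable_linfty X).phiHat_le_iff.2 fun Z hZ => ?_) ?_
  · have := integral_sub_le_toReal_conjugate X hZ
    linarith
  · obtain ⟨Z, hZ, hZX⟩ := exists_conjugate_eq h₀ X
    refine le_trans (le_of_eq ?_) (le_phiHat (X : L0 P) hZ)
    rw [(dualIntegrable_linfty X).expect_sub hZ, hZX, EReal.toReal_coe, sub_sub_cancel]

theorem phiHat_zero (h₀ : IsLebesgueBase φ₀) : phiHat φ₀ 0 = 0 := by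
  have := phiHat_linfty h₀ 0
  rwa [h₀.zero] at this

theorem phiHat_nonneg (h₀ : IsLebesgueBase φ₀) {X : L0 P} (h : 0 ≤ X) : 0 ≤ phiHat φ₀ X :=
  (phiHat_zero h₀).symm.trans_le (phiHat_mono h₀ h)

theorem dualIntegrable_of_phiHat_lt_top (h₀ : IsLebesgueBase φ₀) {X : L0 P} (h : 0 ≤ X)
    (hX : phiHat φ₀ X < ⊤) : DualIntegrable φ₀ X := by
  intro Z hZ
  have hnn : ∀ᵐ ω ∂P, 0 ≤ X ω * Z ω := by
    filter_upwards [AEEqFun.coeFn_le.2 h, AEEqFun.coeFn_zero (μ := P) (β := ℝ),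
      nonneg_of_mem_domConjugate h₀ hZ] with ω h1 h2 h3
    rw [h2] at h1
    exact mul_nonneg h1 h3
  refine ⟨(AEEqFun.aestronglyMeasurable X).mul (integrable_coe Z).1, ?_⟩
  rw [hasFiniteIntegral_iff_ofReal hnn]
  have h1 := (le_phiHat X hZ).trans_lt hX
  rw [expect_of_nonneg hnn, ← coe_toReal_conjugate hZ] at h1
  refine lt_top_iff_ne_top.2 fun htop => ?_
  rw [htop, EReal.coe_ennreal_top, EReal.top_sub_coe] at h1
  exact lt_irrefl _ h1

theorem phiHat_ne_bot (h₀ : IsLebesgueBase φ₀) {X : L0 P} (hX : DualIntegrable φ₀ X) :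
    phiHat φ₀ X ≠ ⊥ := by
  obtain ⟨Z, hZ, -⟩ := exists_conjugate_eq h₀ 0
  have := le_phiHat X hZ
  rw [hX.expect_sub hZ] at this
  exact ne_of_gt ((EReal.bot_lt_coe _).trans_le this)

end PhiHat

/-! ### Truncations, tails and the space `M_u` -/

section Tail

variable {Ω : Type*} [MeasurableSpace Ω] {P : Measure Ω} {φ₀ : LInfty P → ℝ}

theorem coeFn_absTail (X : L0 P) (N : ℕ) :
    ∀ᵐ ω ∂P, absTail X N ω = if (N : ℝ) < |X ω| then |X ω| else 0 := by
  filter_upwards [AEEqFun.coeFn_compMeasurable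
    (Set.indicator {x : ℝ | (N : ℝ) < |x|} (fun x => |x|))
    (measurable_norm.indicator (measurableSet_lt measurable_const measurable_norm)) X] with ω h
  rw [absTail, h]
  simp [Set.indicator_apply]

/-- The truncation of a random variable to the interval `[-N, N]`. -/
noncomputable def clip (N : ℕ) (X : L0 P) : L0 P :=
  AEEqFun.compMeasurable (fun x => max (-(N : ℝ)) (min N x))
    (measurable_const.max (measurable_const.min measurable_id)) X

theorem coeFn_clip (N : ℕ) (X : L0 P) : ∀ᵐ ω ∂P, clip N X ω = max (-(N : ℝ)) (min N (X ω)) :=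
  AEEqFun.coeFn_compMeasurable _ _ X

theorem abs_clip_le (N : ℕ) (x : ℝ) : |max (-(N : ℝ)) (min N x)| ≤ N := by
  have : (0 : ℝ) ≤ N := N.cast_nonneg
  rw [abs_le]
  exact ⟨le_max_left _ _, max_le (by linarith) (min_le_left _ _)⟩

theorem abs_clip_le_abs (N : ℕ) (x : ℝ) : |max (-(N : ℝ)) (min N x)| ≤ |x| := by
  have h : (0 : ℝ) ≤ N := N.cast_nonneg
  rw [abs_le]
  refine ⟨?_, max_le (by linarith [abs_nonneg x]) ((min_le_right _ _).trans (le_abs_self x))⟩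
  exact le_max_of_le_right (le_min (by linarith [abs_nonneg x]) (neg_abs_le x))

theorem clip_eq_self {N : ℕ} {x : ℝ} (h : |x| ≤ N) : max (-(N : ℝ)) (min N x) = x := by
  rw [abs_le] at h
  rw [min_eq_right h.2, max_eq_right h.1]

theorem tendsto_clip (x : ℝ) :
    Tendsto (fun N : ℕ => max (-(N : ℝ)) (min N x)) atTop (𝓝 x) := by
  obtain ⟨K, hK⟩ := exists_nat_ge |x|
  refine tendsto_const_nhds.congr' ?_
  filter_upwards [eventually_ge_atTop K] with N hN
  exact (clip_eq_self (hK.trans (by exact_mod_cast hN))).symm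

theorem absTail_nonneg (X : L0 P) (N : ℕ) {α : ℝ} (hα : 0 ≤ α) : 0 ≤ α • absTail X N := by
  rw [← AEEqFun.coeFn_le]
  filter_upwards [AEEqFun.coeFn_zero (μ := P) (β := ℝ), coeFn_absTail X N,
    AEEqFun.coeFn_smul α (absTail X N)] with ω h1 h2 h3
  rw [h1, h3, Pi.smul_apply, h2, smul_eq_mul]
  refine mul_nonneg hα ?_
  split_ifs <;> simp

variable [IsProbabilityMeasure P]

theorem clip_mem (N : ℕ) (X : L0 P) : clip N X ∈ LInfty P := by
  refine isSolid_linfty (ofMemLp (P := P) (memLp_const (N : ℝ))).2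
    ((abs_le_ofMemLp_const (c := N) ?_).trans ?_)
  · filter_upwards [coeFn_clip N X] with ω h
    rw [h]
    exact abs_clip_le _ _
  · exact le_sup_left

/-- Membership in `M_u` asks for one small value of `φ̂` on the tails, since these values decrease
in `N` and are nonnegative. -/
theorem mem_Mu_iff (h₀ : IsLebesgueBase φ₀) {X : L0 P} :
    X ∈ Mu φ₀ ↔ ∀ α : ℝ, 0 < α → ∀ ε : ℝ, 0 < ε → ∃ N : ℕ, phiHat φ₀ (α • absTail X N) ≤ ε := by
  refine forall₂_congr fun α hα => ⟨fun h ε hε => ?_, fun h => ?_⟩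
  · have := (tendsto_order.1 h).2 (ε : EReal) (by exact_mod_cast hε)
    obtain ⟨N, hN⟩ := this.exists
    exact ⟨N, hN.le⟩
  · refine tendsto_order.2 ⟨fun a ha => Eventually.of_forall fun N => ha.trans_le ?_, fun b hb => ?_⟩
    · exact phiHat_nonneg h₀ (absTail_nonneg X N hα.le)
    · obtain ⟨ε, hε, hεb⟩ := EReal.lt_iff_exists_real_btwn.1 hb
      obtain ⟨N, hN⟩ := h ε (by exact_mod_cast hε)
      filter_upwards [eventually_ge_atTop N] with K hK
      refine lt_of_le_of_lt ((phiHat_mono h₀ ?_).trans hN) hεb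
      rw [← AEEqFun.coeFn_le]
      filter_upwards [coeFn_absTail X N, coeFn_absTail X K, AEEqFun.coeFn_smul α (absTail X N),
        AEEqFun.coeFn_smul α (absTail X K)] with ω h1 h2 h3 h4
      rw [h3, h4, Pi.smul_apply, Pi.smul_apply, h1, h2]
      have hNK : (N : ℝ) ≤ K := by exact_mod_cast hK
      refine mul_le_mul_of_nonneg_left ?_ hα.le
      split_ifs with i1 i2 i2
      · exact le_rfl
      · exact absurd (hNK.trans_lt i1) i2
      · exact abs_nonneg _
      · exact le_rfl

/-- An element of `M_u` is the sum of a bounded part and a tail on which `φ̂` is finite; both are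
integrable against every density in the effective domain. -/
theorem dualIntegrable_of_mem_Mu (h₀ : IsLebesgueBase φ₀) {X : L0 P} (hX : X ∈ Mu φ₀) :
    DualIntegrable φ₀ X := by
  obtain ⟨N, hN⟩ := (mem_Mu_iff h₀).1 hX 1 one_pos 1 one_pos
  have h1 := dualIntegrable_of_phiHat_lt_top h₀ (absTail_nonneg X N zero_le_one)
    (hN.trans_lt (EReal.coe_lt_top _))
  refine (h1.add (dualIntegrable_linfty (ofMemLp (memLp_const (N : ℝ))))).mono ?_
  rw [← AEEqFun.coeFn_le]
  filter_upwards [AEEqFun.coeFn_abs X, AEEqFun.coeFn_abs ((1 : ℝ) • absTail X N +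
      ((ofMemLp (memLp_const (N : ℝ)) : LInfty P) : L0 P)), coeFn_absTail X N,
    AEEqFun.coeFn_smul (1 : ℝ) (absTail X N), coeFn_ofMemLp (P := P) (memLp_const (N : ℝ)),
    AEEqFun.coeFn_add ((1 : ℝ) • absTail X N)
      ((ofMemLp (memLp_const (N : ℝ)) : LInfty P) : L0 P)]
    with ω e1 e2 e3 e4 e5 e6
  rw [e1, e2, e6, Pi.add_apply, e4, e5, Pi.smul_apply, e3, one_smul]
  refine le_trans ?_ (le_abs_self _)
  have : (0 : ℝ) ≤ N := N.cast_nonneg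
  split_ifs with i <;> linarith

/-- The midpoint form of convexity, as used to separate bounded parts from tails. -/
theorem phiHat_le_half (h₀ : IsLebesgueBase φ₀) {X Y W : L0 P}
    (hX : DualIntegrable φ₀ X) (hY : DualIntegrable φ₀ Y) {r s : ℝ}
    (hr : phiHat φ₀ X ≤ r) (hs : phiHat φ₀ Y ≤ s)
    (hW : ∀ᵐ ω ∂P, W ω ≤ (X ω + Y ω) / 2) : phiHat φ₀ W ≤ ((r + s) / 2 : ℝ) := by
  refine (phiHat_mono h₀ ?_).trans ((phiHat_convex hX hY (a := 1 / 2) (b := 1 / 2) (by norm_num)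
    (by norm_num) (by norm_num) hr hs).trans_eq ?_)
  · rw [← AEEqFun.coeFn_le]
    filter_upwards [hW, AEEqFun.coeFn_add ((1 / 2 : ℝ) • X) ((1 / 2 : ℝ) • Y),
      AEEqFun.coeFn_smul (1 / 2 : ℝ) X, AEEqFun.coeFn_smul (1 / 2 : ℝ) Y] with ω h1 h2 h3 h4
    rw [h2, Pi.add_apply, h3, h4]
    simp only [Pi.smul_apply, smul_eq_mul]
    linarith
  · congr 1
    ring

theorem dualIntegrable_absTail (h₀ : IsLebesgueBase φ₀) {X : L0 P} {N : ℕ} {α r : ℝ} (hα : 0 ≤ α)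
    (h : phiHat φ₀ (α • absTail X N) ≤ r) : DualIntegrable φ₀ (α • absTail X N) :=
  dualIntegrable_of_phiHat_lt_top h₀ (absTail_nonneg X N hα) (h.trans_lt (EReal.coe_lt_top _))

theorem add_mem_Mu (h₀ : IsLebesgueBase φ₀) {X Y : L0 P} (hX : X ∈ Mu φ₀) (hY : Y ∈ Mu φ₀) :
    X + Y ∈ Mu φ₀ := by
  rw [mem_Mu_iff h₀] at hX hY ⊢
  intro α hα ε hε
  have hα' : 0 < 4 * α := by positivity
  obtain ⟨N, hN⟩ := hX (4 * α) hα' ε hε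
  obtain ⟨K, hK⟩ := hY (4 * α) hα' ε hε
  refine ⟨2 * max N K, (phiHat_le_half h₀ (dualIntegrable_absTail h₀ hα'.le hN)
    (dualIntegrable_absTail h₀ hα'.le hK) hN hK ?_).trans_eq (by rw [add_self_div_two])⟩
  filter_upwards [coeFn_absTail X N, coeFn_absTail Y K, coeFn_absTail (X + Y) (2 * max N K),
    AEEqFun.coeFn_smul (4 * α) (absTail X N), AEEqFun.coeFn_smul (4 * α) (absTail Y K),
    AEEqFun.coeFn_smul α (absTail (X + Y) (2 * max N K)), AEEqFun.coeFn_add X Y]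
    with ω e1 e2 e3 e4 e5 e6 e7
  rw [e4, e5, e6]
  simp only [Pi.smul_apply, smul_eq_mul]
  rw [e1, e2, e3, e7, Pi.add_apply]
  have hx := abs_nonneg (X ω)
  have hy := abs_nonneg (Y ω)
  have hxy := abs_add_le (X ω) (Y ω)
  have n1 : (N : ℝ) ≤ max (N : ℝ) K := le_max_left _ _
  have n2 : (K : ℝ) ≤ max (N : ℝ) K := le_max_right _ _
  push_cast
  -- On the tail of `X + Y`, the larger of `|X|`, `|Y|` exceeds `max N K` and is at least half of
  -- `|X + Y|`.
  have key : (if 2 * max (N : ℝ) K < |X ω + Y ω| then |X ω + Y ω| else 0) ≤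
      2 * ((if (N : ℝ) < |X ω| then |X ω| else 0) + (if (K : ℝ) < |Y ω| then |Y ω| else 0)) := by
    split_ifs <;> linarith
  have := mul_le_mul_of_nonneg_left key hα.le
  linarith

theorem smul_mem_Mu (h₀ : IsLebesgueBase φ₀) {X : L0 P} (c : ℝ) (hX : X ∈ Mu φ₀) :
    c • X ∈ Mu φ₀ := by
  rw [mem_Mu_iff h₀] at hX ⊢
  intro α hα ε hε
  -- The factor `|c| + 1` instead of `|c|` keeps the scaling positive when `c = 0`.
  have hβ : 0 < α * (|c| + 1) := by positivity
  obtain ⟨N, hN⟩ := hX (α * (|c| + 1)) hβ ε hε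
  obtain ⟨K, hK⟩ := exists_nat_ge (|c| * N)
  refine ⟨K, (phiHat_mono h₀ ?_).trans hN⟩
  rw [← AEEqFun.coeFn_le]
  filter_upwards [coeFn_absTail X N, coeFn_absTail (c • X) K, AEEqFun.coeFn_smul c X,
    AEEqFun.coeFn_smul (α * (|c| + 1)) (absTail X N), AEEqFun.coeFn_smul α (absTail (c • X) K)]
    with ω e1 e2 e3 e4 e5
  rw [e4, e5]
  simp only [Pi.smul_apply, smul_eq_mul]
  rw [e1, e2, e3, Pi.smul_apply, smul_eq_mul, abs_mul, mul_assoc]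
  refine mul_le_mul_of_nonneg_left ?_ hα.le
  have hx := abs_nonneg (X ω)
  have hc := abs_nonneg c
  split_ifs with i1 i2 i2
  · nlinarith
  · have := mul_le_mul_of_nonneg_left (not_lt.1 i2) hc
    linarith
  · positivity
  · simp

theorem isSolid_Mu (h₀ : IsLebesgueBase φ₀) {X Y : L0 P} (hX : X ∈ Mu φ₀) (h : |Y| ≤ |X|) :
    Y ∈ Mu φ₀ := by
  rw [mem_Mu_iff h₀] at hX ⊢
  intro α hα ε hε
  obtain ⟨N, hN⟩ := hX α hα ε hε
  refine ⟨N, (phiHat_mono h₀ ?_).trans hN⟩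
  rw [← AEEqFun.coeFn_le]
  filter_upwards [coeFn_absTail X N, coeFn_absTail Y N, AEEqFun.coeFn_abs X, AEEqFun.coeFn_abs Y,
    AEEqFun.coeFn_le.2 h, AEEqFun.coeFn_smul α (absTail X N), AEEqFun.coeFn_smul α (absTail Y N)]
    with ω e1 e2 e3 e4 e5 e6 e7
  rw [e3, e4] at e5
  rw [e6, e7, Pi.smul_apply, Pi.smul_apply, e1, e2]
  refine mul_le_mul_of_nonneg_left ?_ hα.le
  have hx := abs_nonneg (X ω)
  split_ifs <;> linarith

theorem linfty_subset_Mu (h₀ : IsLebesgueBase φ₀) (X : LInfty P) : (X : L0 P) ∈ Mu φ₀ := by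
  rw [mem_Mu_iff h₀]
  intro α hα ε hε
  obtain ⟨N, hN⟩ := exists_nat_ge (eLpNorm (X : L0 P) ∞ P).toReal
  refine ⟨N, ?_⟩
  have hz : α • absTail (X : L0 P) N = 0 := by
    refine AEEqFun.ext ?_
    filter_upwards [ae_norm_linfty_le X, coeFn_absTail (X : L0 P) N,
      AEEqFun.coeFn_zero (μ := P) (β := ℝ),
      AEEqFun.coeFn_smul α (absTail (X : L0 P) N)] with ω e1 e2 e3 e4
    rw [Real.norm_eq_abs] at e1
    rw [e4, e3, Pi.smul_apply, e2, if_neg (not_lt.2 (e1.trans hN))]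
    simp
  rw [hz, phiHat_zero h₀]
  exact_mod_cast hε.le

theorem phiHat_ne_top_of_mem_Mu (h₀ : IsLebesgueBase φ₀) {X : L0 P} (hX : X ∈ Mu φ₀) :
    phiHat φ₀ X ≠ ⊤ := by
  obtain ⟨N, hN⟩ := (mem_Mu_iff h₀).1 hX 2 two_pos 1 one_pos
  let C : LInfty P := ofMemLp (memLp_const (2 * N : ℝ))
  refine ne_of_lt (lt_of_le_of_lt (phiHat_le_half h₀ (dualIntegrable_linfty C)
    (dualIntegrable_absTail h₀ zero_le_two hN) (phiHat_linfty h₀ C).le hN ?_)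
    (EReal.coe_lt_top _))
  filter_upwards [coeFn_ofMemLp (P := P) (memLp_const (2 * N : ℝ)), coeFn_absTail X N,
    AEEqFun.coeFn_smul (2 : ℝ) (absTail X N)] with ω e1 e2 e3
  rw [e1, e3, Pi.smul_apply, e2, smul_eq_mul]
  have := le_abs_self (X ω)
  have : (0 : ℝ) ≤ N := N.cast_nonneg
  split_ifs <;> linarith

theorem exists_phiHat_eq_coe (h₀ : IsLebesgueBase φ₀) {X : L0 P} (hX : X ∈ Mu φ₀) :
    ∃ r : ℝ, phiHat φ₀ X = r :=
  ⟨_, (EReal.coe_toReal (phiHat_ne_top_of_mem_Mu h₀ hX)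
    (phiHat_ne_bot h₀ (dualIntegrable_of_mem_Mu h₀ hX))).symm⟩

/-- The space `M_u` as a linear subspace of `L⁰`. -/
def muSubmodule (h₀ : IsLebesgueBase φ₀) : Submodule ℝ (L0 P) where
  carrier := Mu φ₀
  add_mem' := add_mem_Mu h₀
  zero_mem' := linfty_subset_Mu h₀ 0
  smul_mem' c _ hX := smul_mem_Mu h₀ c hX

end Tail

/-! ### The Lebesgue property of `φ̂` on `M_u` -/

section Lebesgue

variable {Ω : Type*} [MeasurableSpace Ω] {P : Measure Ω} {φ₀ : LInfty P → ℝ}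

/-- Lower semicontinuity of `φ̂` under dominated a.s. convergence: each `E[XZ]` is continuous by
dominated convergence. -/
theorem eventually_lt_phiHat {X : ℕ → L0 P} {X' Y : L0 P} (hY : DualIntegrable φ₀ Y)
    (hXY : ∀ n, |X n| ≤ Y) (hX' : DualIntegrable φ₀ X')
    (hlim : ∀ᵐ ω ∂P, Tendsto (fun n => X n ω) atTop (𝓝 (X' ω))) {a : EReal}
    (ha : a < phiHat φ₀ X') : ∀ᶠ n in atTop, a < phiHat φ₀ (X n) := by
  obtain ⟨Z, ha⟩ := lt_iSup_iff.1 ha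
  obtain ⟨hZ, ha⟩ := lt_iSup_iff.1 ha
  rw [hX'.expect_sub hZ] at ha
  have hbd : ∀ n, ∀ᵐ ω ∂P, |X n ω| ≤ Y ω := by
    intro n
    filter_upwards [AEEqFun.coeFn_le.2 (hXY n), AEEqFun.coeFn_abs (X n)] with ω e1 e2
    rwa [e2] at e1
  have hX : ∀ n, DualIntegrable φ₀ (X n) := fun n => hY.mono ((hXY n).trans le_sup_left)
  have lim : Tendsto (fun n => ∫ ω, X n ω * Z ω ∂P) atTop (𝓝 (∫ ω, X' ω * Z ω ∂P)) := by
    refine tendsto_integral_of_dominated_convergence (fun ω => ‖Y ω * Z ω‖)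
      (fun n => (hX n Z hZ).aestronglyMeasurable) (hY Z hZ).norm (fun n => ?_) ?_
    · filter_upwards [hbd n] with ω e1
      rw [norm_mul, norm_mul]
      exact mul_le_mul_of_nonneg_right (e1.trans (le_abs_self _)) (norm_nonneg _)
    · filter_upwards [hlim] with ω e1
      exact e1.mul_const _
  have lim2 := EReal.tendsto_coe.2 (lim.sub_const (conjugate φ₀ Z).toReal)
  filter_upwards [(tendsto_order.1 lim2).1 a ha] with n hn
  refine hn.trans_le ?_
  rw [← (hX n).expect_sub hZ]
  exact le_phiHat (X n) hZ

variable [IsProbabilityMeasure P]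

/-- Along an order bounded a.s. null sequence of nonnegative elements of `M_u` the values of `φ̂`
become arbitrarily small: the truncations are handled by the Lebesgue property of `φ₀`, the rest by
a tail of the dominating element. -/
theorem eventually_phiHat_le (h₀ : IsLebesgueBase φ₀) {W : ℕ → L0 P} {Y : L0 P}
    (hY : Y ∈ Mu φ₀) (hW : ∀ n, ∀ᵐ ω ∂P, 0 ≤ W n ω ∧ W n ω ≤ Y ω)
    (hlim : ∀ᵐ ω ∂P, Tendsto (fun n => W n ω) atTop (𝓝 0)) {α ε : ℝ} (hα : 0 < α) (hε : 0 < ε) :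
    ∀ᶠ n in atTop, phiHat φ₀ (α • W n) ≤ ε := by
  have hα2 : 0 < 2 * α := by positivity
  obtain ⟨N, hN⟩ := (mem_Mu_iff h₀).1 hY (2 * α) hα2 ε hε
  let V : ℕ → LInfty P := fun n => (2 * α) • ⟨clip N (W n), clip_mem N (W n)⟩
  have hV : ∀ n, ∀ᵐ ω ∂P, (V n : L0 P) ω = 2 * α * max (-(N : ℝ)) (min N (W n ω)) := by
    intro n
    filter_upwards [AEEqFun.coeFn_smul (2 * α) (clip N (W n)), coeFn_clip N (W n)] with ω e1 e2
    change ((2 * α) • clip N (W n)) ω = _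
    rw [e1, Pi.smul_apply, e2, smul_eq_mul]
  have hφV : Tendsto (fun n => φ₀ (V n)) atTop (𝓝 0) := by
    rw [← h₀.zero]
    refine h₀.tendsto V 0 (ofMemLp (memLp_const (2 * α * N)))
      (fun n => abs_le_ofMemLp_const ?_) ?_
    · filter_upwards [hV n] with ω e1
      rw [e1, abs_mul, abs_of_pos hα2]
      exact mul_le_mul_of_nonneg_left (abs_clip_le _ _) hα2.le
    · filter_upwards [ae_all_iff.2 hV, hlim, AEEqFun.coeFn_zero (μ := P) (β := ℝ)] with ω e1 e2 e3
      simp only [e1, Submodule.coe_zero, e3]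
      have hc : Continuous fun x : ℝ => 2 * α * max (-(N : ℝ)) (min N x) := by fun_prop
      have := (hc.tendsto 0).comp e2
      simpa [Function.comp_def] using this
  filter_upwards [(tendsto_order.1 hφV).2 ε hε] with n hn
  refine (phiHat_le_half h₀ (dualIntegrable_linfty (V n)) (dualIntegrable_absTail h₀ hα2.le hN)
    ((phiHat_linfty h₀ (V n)).trans_le (EReal.coe_le_coe_iff.2 hn.le)) hN ?_).trans_eq
      (by rw [add_self_div_two])
  filter_upwards [hV n, hW n, coeFn_absTail Y N, AEEqFun.coeFn_smul (2 * α) (absTail Y N),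
    AEEqFun.coeFn_smul α (W n)] with ω e1 e2 e3 e4 e5
  rw [e1, e4, e5, Pi.smul_apply, Pi.smul_apply, e3, smul_eq_mul, smul_eq_mul]
  have hN0 : (0 : ℝ) ≤ N := N.cast_nonneg
  have habs : |Y ω| = Y ω := abs_of_nonneg (e2.1.trans e2.2)
  have key : W n ω ≤ max (-(N : ℝ)) (min N (W n ω)) + (if (N : ℝ) < |Y ω| then |Y ω| else 0) := by
    rw [habs]
    split_ifs with i
    · have : 0 ≤ max (-(N : ℝ)) (min N (W n ω)) := le_max_of_le_right (le_min hN0 e2.1)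
      linarith [e2.2]
    · have : |W n ω| ≤ N := by
        rw [abs_of_nonneg e2.1]
        exact e2.2.trans (not_lt.1 i)
      rw [clip_eq_self this, add_zero]
  have := mul_le_mul_of_nonneg_left key hα.le
  linarith

theorem hasLebesgueProperty_phiHat (h₀ : IsLebesgueBase φ₀) :
    HasLebesgueProperty (muSubmodule h₀) (fun X => phiHat φ₀ X) := by
  intro X X' Y hXY hlim
  have hbd : ∀ᵐ ω ∂P, ∀ n, |(X n : L0 P) ω| ≤ (Y : L0 P) ω := by
    refine ae_all_iff.2 fun n => ?_
    filter_upwards [AEEqFun.coeFn_le.2 (hXY n), AEEqFun.coeFn_abs (X n : L0 P)] with ω e1 e2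
    rwa [e2] at e1
  refine tendsto_order.2 ⟨fun a ha => eventually_lt_phiHat (dualIntegrable_of_mem_Mu h₀ Y.2) hXY
    (dualIntegrable_of_mem_Mu h₀ X'.2) hlim ha, fun b hb => ?_⟩
  obtain ⟨r, hr⟩ := exists_phiHat_eq_coe h₀ X'.2
  obtain ⟨s, hs⟩ := exists_phiHat_eq_coe h₀ (smul_mem_Mu h₀ 2 X'.2)
  obtain ⟨c, hc, hcb⟩ := EReal.lt_iff_exists_real_btwn.1 hb
  have hc : r < c := EReal.coe_lt_coe_iff.1 (hr ▸ hc)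
  -- `X n ≤ (1 - l) X' + l (2 X' + 2 W / l) / 2` with `W = |X n - X'|`; the right-hand side has
  -- `φ̂`-value at most `(1 - l) r + l (s + 1) / 2` for large `n`, which is below `c` for small `l`.
  obtain ⟨l, hl0, hl1, hl⟩ : ∃ l : ℝ, 0 < l ∧ l < 1 ∧ (1 - l) * r + l * ((s + 1) / 2) < c := by
    have hcont : Tendsto (fun l : ℝ => (1 - l) * r + l * ((s + 1) / 2)) (𝓝[>] 0) (𝓝 r) := by
      have : Continuous fun l : ℝ => (1 - l) * r + l * ((s + 1) / 2) := by fun_prop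
      simpa using (this.tendsto 0).mono_left nhdsWithin_le_nhds
    have := ((tendsto_order.1 hcont).2 c hc).and (Ioo_mem_nhdsGT (zero_lt_one (α := ℝ)))
    obtain ⟨l, h1, h2⟩ := this.exists
    exact ⟨l, h2.1, h2.2, h1⟩
  let W : ℕ → L0 P := fun n => |(X n : L0 P) - (X' : L0 P)|
  have hW : ∀ n, ∀ᵐ ω ∂P, W n ω = |(X n : L0 P) ω - (X' : L0 P) ω| := by
    intro n
    filter_upwards [AEEqFun.coeFn_abs ((X n : L0 P) - (X' : L0 P)),
      AEEqFun.coeFn_sub (X n : L0 P) (X' : L0 P)] with ω e1 e2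
    rw [e1, e2, Pi.sub_apply]
  have h2Y : ∀ᵐ ω ∂P, ((2 : ℝ) • (Y : L0 P)) ω = 2 * (Y : L0 P) ω :=
    AEEqFun.coeFn_smul (2 : ℝ) (Y : L0 P)
  have hWY : ∀ n, ∀ᵐ ω ∂P, 0 ≤ W n ω ∧ W n ω ≤ ((2 : ℝ) • (Y : L0 P)) ω := by
    intro n
    filter_upwards [hW n, hbd, hlim, h2Y] with ω e1 e2 e3 e4
    rw [e1, e4]
    refine ⟨abs_nonneg _, (abs_sub _ _).trans ?_⟩
    have := le_of_tendsto e3.abs (Eventually.of_forall e2)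
    linarith [e2 n]
  have h2Ymem := smul_mem_Mu h₀ 2 Y.2
  have hWlim : ∀ᵐ ω ∂P, Tendsto (fun n => W n ω) atTop (𝓝 0) := by
    filter_upwards [ae_all_iff.2 hW, hlim] with ω e1 e2
    simp only [e1]
    simpa using (e2.sub_const ((X' : L0 P) ω)).abs
  filter_upwards [eventually_phiHat_le h₀ h2Ymem hWY hWlim (α := 2 / l) (by positivity) one_pos]
    with n hn
  refine lt_of_le_of_lt ?_ hcb
  have hWd : DualIntegrable φ₀ ((2 / l) • W n) := by
    refine DualIntegrable.smul ?_ _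
    refine (dualIntegrable_of_mem_Mu h₀ h2Ymem).mono ?_
    rw [← AEEqFun.coeFn_le]
    filter_upwards [hWY n, AEEqFun.coeFn_abs (W n), AEEqFun.coeFn_abs ((2 : ℝ) • (Y : L0 P))]
      with ω e1 e2 e3
    rw [e2, e3, abs_of_nonneg e1.1]
    exact e1.2.trans (le_abs_self _)
  let V : L0 P := (1 / 2 : ℝ) • ((2 : ℝ) • (X' : L0 P) + (2 / l) • W n)
  have hVadd : ∀ᵐ ω ∂P, V ω = (2 * (X' : L0 P) ω + 2 / l * W n ω) / 2 := by
    filter_upwards [AEEqFun.coeFn_smul (1 / 2 : ℝ) ((2 : ℝ) • (X' : L0 P) + (2 / l) • W n),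
      AEEqFun.coeFn_add ((2 : ℝ) • (X' : L0 P)) ((2 / l) • W n),
      AEEqFun.coeFn_smul (2 : ℝ) (X' : L0 P), AEEqFun.coeFn_smul (2 / l) (W n)] with ω e1 e2 e3 e4
    simp only [V]
    rw [e1, Pi.smul_apply, e2, Pi.add_apply, e3, e4]
    simp only [Pi.smul_apply, smul_eq_mul]
    ring
  have h2X := dualIntegrable_of_mem_Mu h₀ (smul_mem_Mu h₀ 2 X'.2)
  have hV : phiHat φ₀ V ≤ ((s + 1) / 2 : ℝ) := by
    refine phiHat_le_half h₀ h2X hWd hs.le hn ?_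
    filter_upwards [hVadd, AEEqFun.coeFn_smul (2 : ℝ) (X' : L0 P),
      AEEqFun.coeFn_smul (2 / l) (W n)] with ω e1 e2 e3
    rw [e1, e2, e3]
    rfl
  have hVd : DualIntegrable φ₀ V := (h2X.add hWd).smul _
  refine (phiHat_mono h₀ ?_).trans ((phiHat_convex (dualIntegrable_of_mem_Mu h₀ X'.2) hVd
    (a := 1 - l) (b := l) (by linarith) hl0.le (by ring) hr.le hV).trans
      (EReal.coe_le_coe_iff.2 hl.le))
  rw [← AEEqFun.coeFn_le]
  filter_upwards [hVadd, hW n, AEEqFun.coeFn_add ((1 - l) • (X' : L0 P)) (l • V),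
    AEEqFun.coeFn_smul (1 - l) (X' : L0 P), AEEqFun.coeFn_smul l V] with ω e1 e2 e3 e4 e5
  rw [e3, Pi.add_apply, e4, e5]
  simp only [Pi.smul_apply, smul_eq_mul]
  rw [e1, e2]
  have h1 : (1 - l) * (X' : L0 P) ω +
      l * ((2 * (X' : L0 P) ω + 2 / l * |(X n : L0 P) ω - (X' : L0 P) ω|) / 2) =
      (X' : L0 P) ω + |(X n : L0 P) ω - (X' : L0 P) ω| := by
    field_simp
    ring
  rw [h1]
  linarith [le_abs_self ((X n : L0 P) ω - (X' : L0 P) ω)]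

theorem isMonotoneConvex_phiHat (h₀ : IsLebesgueBase φ₀) :
    IsMonotoneConvex (muSubmodule h₀) (fun X => phiHat φ₀ X) where
  ne_bot X := phiHat_ne_bot h₀ (dualIntegrable_of_mem_Mu h₀ X.2)
  proper := ⟨0, phiHat_ne_top_of_mem_Mu h₀ (muSubmodule h₀).zero_mem⟩
  mono _ _ h := phiHat_mono h₀ h
  convex X Y a b ha hb hab := by
    obtain ⟨r, hr⟩ := exists_phiHat_eq_coe h₀ X.2
    obtain ⟨s, hs⟩ := exists_phiHat_eq_coe h₀ Y.2
    have := phiHat_convex (dualIntegrable_of_mem_Mu h₀ X.2) (dualIntegrable_of_mem_Mu h₀ Y.2)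
      ha.le hb.le hab hr.le hs.le
    rw [hr, hs]
    exact_mod_cast this

theorem isLebesgueExtension_phiHat (h₀ : IsLebesgueBase φ₀) :
    IsLebesgueExtension (LInfty P) (fun X => (φ₀ X : EReal)) (muSubmodule h₀)
      (fun X => phiHat φ₀ X) where
  solid _ hX _ h := isSolid_Mu h₀ hX h
  monotoneConvex := isMonotoneConvex_phiHat h₀
  lebesgue := hasLebesgueProperty_phiHat h₀
  extends_base := ⟨fun X hX => linfty_subset_Mu h₀ ⟨X, hX⟩, phiHat_linfty h₀⟩

theorem Mu_subset_D0 (h₀ : IsLebesgueBase φ₀) : Mu φ₀ ⊆ D0 φ₀ := by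
  intro X hX Z hZ
  refine (dualIntegrable_of_mem_Mu h₀ hX Z hZ).mono
    (((AEEqFun.aestronglyMeasurable X).neg.sup aestronglyMeasurable_const).mul
      (integrable_coe Z).1) (Eventually.of_forall fun ω => ?_)
  rw [norm_mul, norm_mul]
  refine mul_le_mul_of_nonneg_right ?_ (norm_nonneg _)
  rw [Real.norm_eq_abs, Real.norm_eq_abs, abs_of_nonneg (le_max_right _ _)]
  exact max_le (neg_le_abs _) (abs_nonneg _)

end Lebesgue

/-! ### Maximality -/

section Maximality

variable {Ω : Type*} [MeasurableSpace Ω] {P : Measure Ω} [IsProbabilityMeasure P]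
  {φ₀ : LInfty P → ℝ} {𝒴 : Submodule ℝ (L0 P)} {ψ : 𝒴 → EReal}

/-- On nonnegative elements every Lebesgue extension of `φ₀` dominates `φ̂`: by monotone
convergence `E[WZ] = lim E[(W ∧ n) Z]`, and `E[(W ∧ n) Z] - φ₀*(Z) ≤ φ₀ (W ∧ n) ≤ ψ W`. -/
theorem phiHat_le_of_isLebesgueExtension (h₀ : IsLebesgueBase φ₀)
    (hψ : IsLebesgueExtension (LInfty P) (fun X => (φ₀ X : EReal)) 𝒴 ψ) (W : 𝒴)
    (hW : 0 ≤ (W : L0 P)) : phiHat φ₀ W ≤ ψ W := by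
  obtain ⟨hle, hext⟩ := hψ.extends_base
  have hW0 : ∀ᵐ ω ∂P, 0 ≤ (W : L0 P) ω := by
    filter_upwards [AEEqFun.coeFn_le.2 hW, AEEqFun.coeFn_zero (μ := P) (β := ℝ)] with ω e1 e2
    rwa [e2] at e1
  have hclip : ∀ᵐ ω ∂P, ∀ n, clip n (W : L0 P) ω = max (-(n : ℝ)) (min n ((W : L0 P) ω)) :=
    ae_all_iff.2 fun n => coeFn_clip n _
  by_cases htop : ψ W = ⊤
  · rw [htop]
    exact le_top
  lift ψ W to ℝ using ⟨htop, hψ.monotoneConvex.ne_bot W⟩ with r hr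
  have hbound : ∀ n : ℕ, φ₀ ⟨clip n (W : L0 P), clip_mem n _⟩ ≤ r := by
    intro n
    have := hψ.monotoneConvex.mono ⟨clip n (W : L0 P), hle (clip_mem n _)⟩ W ?_
    · rw [hext ⟨_, clip_mem n _⟩, ← hr] at this
      exact_mod_cast this
    · rw [← AEEqFun.coeFn_le]
      filter_upwards [hW0, hclip] with ω e1 e2
      rw [e2 n]
      exact (le_abs_self _).trans ((abs_clip_le_abs _ _).trans_eq (abs_of_nonneg e1))
  refine iSup₂_le fun Z hZ => ?_
  have hZ0 := nonneg_of_mem_domConjugate h₀ hZ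
  rw [expect_of_nonneg (by filter_upwards [hW0, hZ0] with ω e1 e2 using mul_nonneg e1 e2)]
  have hn : ∀ n : ℕ, ∫⁻ ω, ENNReal.ofReal (clip n (W : L0 P) ω * Z ω) ∂P ≤
      ENNReal.ofReal (r + (conjugate φ₀ Z).toReal) := by
    intro n
    have hi := integrable_linfty_mul ⟨_, clip_mem n (W : L0 P)⟩ (integrable_coe Z)
    rw [← ofReal_integral_eq_lintegral_ofReal hi]
    · refine ENNReal.ofReal_le_ofReal ?_
      have := integral_sub_le_toReal_conjugate ⟨_, clip_mem n (W : L0 P)⟩ hZ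
      linarith [hbound n]
    · filter_upwards [hW0, hZ0, hclip] with ω e1 e2 e3
      change 0 ≤ clip n (W : L0 P) ω * Z ω
      rw [e3]
      exact mul_nonneg (le_max_of_le_right (le_min n.cast_nonneg e1)) e2
  have hlim : Tendsto (fun n : ℕ => ∫⁻ ω, ENNReal.ofReal (clip n (W : L0 P) ω * Z ω) ∂P) atTop
      (𝓝 (∫⁻ ω, ENNReal.ofReal ((W : L0 P) ω * Z ω) ∂P)) := by
    refine lintegral_tendsto_of_tendsto_of_monotone (fun n => ?_) ?_ ?_
    · exact ((AEEqFun.aestronglyMeasurable _).mul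
        (integrable_coe Z).1).aemeasurable.ennreal_ofReal
    · filter_upwards [hclip, hW0, hZ0] with ω e1 e2 e3 n k hnk
      simp only [e1]
      refine ENNReal.ofReal_le_ofReal (mul_le_mul_of_nonneg_right ?_ e3)
      have h1 : (n : ℝ) ≤ k := by exact_mod_cast hnk
      have h2 : (0 : ℝ) ≤ n := n.cast_nonneg
      rw [max_eq_right ((neg_nonpos.2 h2).trans (le_min h2 e2))]
      exact le_max_of_le_right (min_le_min_right _ h1)
    · filter_upwards [hclip] with ω e1
      simp only [e1]
      exact (ENNReal.continuous_ofReal.tendsto _).comp ((tendsto_clip _).mul_const _)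
  have hfin := le_of_tendsto' hlim hn
  rw [← coe_toReal_conjugate hZ]
  have hc : 0 ≤ r + (conjugate φ₀ Z).toReal := by
    have h1 := integral_sub_le_toReal_conjugate 0 hZ
    have h2 : ψ 0 ≤ ψ W := hψ.monotoneConvex.mono 0 W hW
    have h3 : ψ 0 = φ₀ 0 := hext 0
    rw [h3, h₀.zero, ← hr] at h2
    have h4 : ∫ ω, ((0 : LInfty P) : L0 P) ω * Z ω ∂P = 0 := by
      rw [← integral_zero Ω ℝ (μ := P)]
      refine integral_congr_ae ?_
      filter_upwards [AEEqFun.coeFn_zero (μ := P) (β := ℝ)] with ω e1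
      rw [Submodule.coe_zero, e1]
      simp
    rw [h4, h₀.zero] at h1
    have h5 : 0 ≤ r := by exact_mod_cast h2
    linarith
  refine EReal.sub_le_of_le_add ((EReal.coe_ennreal_le_coe_ennreal_iff.2 hfin).trans_eq ?_)
  rw [EReal.coe_ennreal_ofReal, max_eq_left hc, EReal.coe_add]

theorem subset_Mu_of_isLebesgueExtension (h₀ : IsLebesgueBase φ₀)
    (hψ : IsLebesgueExtension (LInfty P) (fun X => (φ₀ X : EReal)) 𝒴 ψ) {X : L0 P} (hX : X ∈ 𝒴) :
    X ∈ Mu φ₀ := by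
  rw [mem_Mu_iff h₀]
  intro α hα ε hε
  have habs : |X| ∈ 𝒴 := hψ.solid hX (abs_abs_l0 X).le
  have htail : ∀ N, absTail X N ∈ 𝒴 := by
    refine fun N => hψ.solid hX ?_
    rw [← AEEqFun.coeFn_le]
    filter_upwards [coeFn_absTail X N, AEEqFun.coeFn_abs X, AEEqFun.coeFn_abs (absTail X N)]
      with ω e1 e2 e3
    rw [e3, e2, e1]
    split_ifs <;> simp
  let T : ℕ → 𝒴 := fun N => α • ⟨absTail X N, htail N⟩
  have hT : ∀ N, ∀ᵐ ω ∂P, (T N : L0 P) ω = α * if (N : ℝ) < |X ω| then |X ω| else 0 := by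
    intro N
    filter_upwards [coeFn_absTail X N, AEEqFun.coeFn_smul α (absTail X N)] with ω e1 e2
    change (α • absTail X N) ω = _
    rw [e2, Pi.smul_apply, e1, smul_eq_mul]
  have hlim := hψ.lebesgue T 0 (α • ⟨|X|, habs⟩) (fun N => ?_) ?_
  · obtain ⟨hle, hext⟩ := hψ.extends_base
    have h0 : ψ 0 = φ₀ 0 := hext 0
    rw [h0, h₀.zero] at hlim
    obtain ⟨N, hN⟩ := ((tendsto_order.1 hlim).2 (ε : EReal) (by exact_mod_cast hε)).exists
    exact ⟨N, (phiHat_le_of_isLebesgueExtension h₀ hψ (T N)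
      (absTail_nonneg X N hα.le)).trans hN.le⟩
  · rw [← AEEqFun.coeFn_le]
    filter_upwards [hT N, AEEqFun.coeFn_abs (T N : L0 P), AEEqFun.coeFn_smul α |X|,
      AEEqFun.coeFn_abs X] with ω e1 e2 e3 e4
    change _ ≤ (α • |X|) ω
    rw [e2, e1, e3, Pi.smul_apply, e4, smul_eq_mul, abs_mul, abs_of_pos hα]
    refine mul_le_mul_of_nonneg_left ?_ hα.le
    split_ifs <;> simp
  · filter_upwards [ae_all_iff.2 hT, AEEqFun.coeFn_zero (μ := P) (β := ℝ)] with ω e1 e2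
    rw [Submodule.coe_zero, e2]
    obtain ⟨K, hK⟩ := exists_nat_ge |X ω|
    refine tendsto_const_nhds.congr' ?_
    filter_upwards [eventually_ge_atTop K] with N hN
    have : |X ω| ≤ N := hK.trans (by exact_mod_cast hN)
    rw [e1, if_neg (not_lt.2 this), mul_zero]
    rfl

/-- Both `ψ` and `φ̂` have the Lebesgue property and agree on the truncations of `X`. -/
theorem eq_phiHat_of_isLebesgueExtension (h₀ : IsLebesgueBase φ₀)
    (hψ : IsLebesgueExtension (LInfty P) (fun X => (φ₀ X : EReal)) 𝒴 ψ) (X : 𝒴) :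
    ψ X = phiHat φ₀ X := by
  have key : ∀ {𝒳 : Submodule ℝ (L0 P)} {φ : 𝒳 → EReal},
      IsLebesgueExtension (LInfty P) (fun X => (φ₀ X : EReal)) 𝒳 φ → ∀ X : 𝒳,
      Tendsto (fun n : ℕ => (φ₀ ⟨clip n (X : L0 P), clip_mem n _⟩ : EReal)) atTop (𝓝 (φ X)) := by
    intro 𝒳 φ hφ X
    obtain ⟨hle, hext⟩ := hφ.extends_base
    simp only [← hext]
    refine hφ.lebesgue _ X ⟨|(X : L0 P)|, hφ.solid X.2 (abs_abs_l0 _).le⟩ (fun n => ?_) ?_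
    · rw [← AEEqFun.coeFn_le]
      filter_upwards [coeFn_clip n (X : L0 P), AEEqFun.coeFn_abs (X : L0 P),
        AEEqFun.coeFn_abs (clip n (X : L0 P))] with ω e1 e2 e3
      rw [e3, e2, e1]
      exact abs_clip_le_abs _ _
    · filter_upwards [ae_all_iff.2 fun n => coeFn_clip n (X : L0 P)] with ω e1
      simp only [e1]
      exact tendsto_clip _
  exact tendsto_nhds_unique (key hψ X) (key (isLebesgueExtension_phiHat h₀)
    ⟨X, subset_Mu_of_isLebesgueExtension h₀ hψ X.2⟩)

end Maximality

end LebExt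

theorem mainTheorem1 {Ω : Type*} [MeasurableSpace Ω] (P : Measure Ω) [IsProbabilityMeasure P]
    (φ₀ : LebExt.LInfty P → ℝ)
    (hconv : LebExt.IsMonotoneConvex (LebExt.LInfty P) (fun X => (φ₀ X : EReal)))
    (hleb : LebExt.HasLebesgueProperty (LebExt.LInfty P) (fun X => (φ₀ X : EReal)))
    (hzero : φ₀ 0 = 0) :
    ∃ M : Submodule ℝ (LebExt.L0 P),
      (M : Set (LebExt.L0 P)) = LebExt.Mu φ₀ ∧
      (M : Set (LebExt.L0 P)) ⊆ LebExt.D0 φ₀ ∧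
      (∀ X ∈ M, LebExt.phiHat φ₀ X ≠ ⊥ ∧ LebExt.phiHat φ₀ X ≠ ⊤) ∧
      LebExt.IsMaximumLebesgueExtension (LebExt.LInfty P) (fun X => (φ₀ X : EReal))
        M (fun X => LebExt.phiHat φ₀ X) := by
  have h₀ := LebExt.isLebesgueBase hconv hleb hzero
  exact ⟨LebExt.muSubmodule h₀, rfl, LebExt.Mu_subset_D0 h₀, fun X hX =>
    ⟨LebExt.phiHat_ne_bot h₀ (LebExt.dualIntegrable_of_mem_Mu h₀ hX),
      LebExt.phiHat_ne_top_of_mem_Mu h₀ hX⟩,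
    LebExt.isLebesgueExtension_phiHat h₀, fun _ _ hψ =>
      ⟨fun _ hX => LebExt.subset_Mu_of_isLebesgueExtension h₀ hψ hX,
        LebExt.eq_phiHat_of_isLebesgueExtension h₀ hψ⟩⟩
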